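/- Let $A\in\mathrm{GL}(d,\mathbb R)$ with $|\det A|>1$ be expanding on a subspace: every (complex) eigenvalue $\lambda$ of $A$ satisfies $|\lambda|\ge 1$, some eigenvalue satisfies $|\lambda|>1$, and eigenvalues with $|\lambda|=1$ have only Jordan blocks of order one. Let $\Gamma\subseteq\mathbb R^d$ be a closed, co-compact subgroup with a Haar measure $\mu$, let $P$ be a finite set and let $\{g_p\}_{p\in P}\subset L^2(\mathbb R^d)$. For $j\in\mathbb Z$ put $\Gamma_j=A^{-j}\Gamma$, equipped with the image of $\mu$ under $A^{-j}$, and $g_{j,p}=D_{A^j}g_p=|\det A|^{j/2}g_p(A^j\,\cdot)$. Let $\mathrm{covol}(\Gamma_j)$ be the total mass of the measure on $\mathbb R^d/\Gamma_j$ given by Weil's integral formula, let $\Gamma_j^\perp=\{\omega\in\mathbb R^d: e^{2\pi i\langle x,\omega\rangle}=1\ \ \forall x\in\Gamma_j\}$, and let $\hat f$ be the Fourier-Plancherel transform (kernel $e^{-2\pi i\langle x,\omega\rangle}$) of $f\in L^2(\mathbb R^d)$. Let $\mathcal E$ be the family of closed Lebesgue null sets $E\subset\mathbb R^d$. For $E\in\mathcal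 E$ the wavelet system $\bigcup_{j\in\mathbb Z}\{T_\gamma D_{A^j}g_p:\gamma\in A^{-j}\Gamma,\ p\in P\}$ satisfies the local integrability condition (LIC) with respect to $E$ if $$\sum_{j\in\mathbb Z}\frac1{\mathrm{covol}(\Gamma_j)}\sum_{p\in P}\sum_{\alpha\in\Gamma_j^\perp}\int_{\operatorname{supp}\hat f}|\hat f(\omega+\alpha)\,\hat g_{j,p}(\omega)|^2\,d\omega<\infty$$ for all $f\in L^2(\mathbb R^d)$ such that $\hat f$ is essentially bounded with compact (essential) support contained in $\mathbb R^d\setminus E$. It satisfies the Calderón integrability condition with respect to $E$ if $$\sum_{j\in\mathbb Z}\frac1{\mathrm{covol}(\Gamma_j)}\sum_{p\in P}|\hat g_{j,p}|^2\in L^1_{\rm loc}(\mathbb R^d\setminus E),$$ that is, this function has a finite integral over each compact subset of $\mathbb R^d\setminus E$. Let $N\subset\mathbb R^d$ be the set of real vectors in the complex linear span of the eigenvectors of $A^T$ with eigenvalues of modulus one (so $N=\{0\}$ if all eigenvalues have modulus larger than one). Then: 1. for every $E\in\mathcal E$ with $N\subseteq E$, the system satisfies the LIC with respect to $E$ if and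 only if it satisfies the Calderón integrability condition with respect to $E$; 2. for every $E\in\mathcal E$, if the system satisfies the LIC with respect to $E$, then it satisfies the Calderón integrability condition with respect to $E$; 3. the system satisfies the LIC with respect to some $E\in\mathcal E$ if and only if it satisfies the Calderón integrability condition with respect to some $E\in\mathcal E$. -/

import Mathlib

open MeasureTheory Set
open scoped FourierTransform ENNReal RealInnerProductSpace

noncomputable section

/-- The group `ℝᵈ` with its Euclidean structure.  Its Haar measure is Lebesgue measure `volume`.  The
dual group is identified with `ℝᵈ` through the characters `x ↦ exp (2 π i ⟪x, ω⟫)`, for which the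
Plancherel measure is again Lebesgue measure. -/
abbrev Eucl (d : ℕ) : Type := EuclideanSpace ℝ (Fin d)

/-- The Hilbert space `L²(ℝᵈ)` of complex valued functions. -/
abbrev L2 (d : ℕ) : Type := Lp ℂ 2 (volume : Measure (Eucl d))

/-- A representative of the Fourier-Plancherel transform of `f ∈ L²(ℝᵈ)` (the unitary extension of
`f ↦ (ω ↦ ∫ f(x) exp (-2 π i ⟪x, ω⟫) dx)`). -/
def hat {d : ℕ} (f : L2 d) : Eucl d → ℂ :=
  (𝓕 f : L2 d)

/-! ### Support of a measurable function and the spaces `𝓓_E` -/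

/-- The (essential) support of a function defined up to null sets: the complement of the largest
open set on which it vanishes almost everywhere. -/
def essSupp {d : ℕ} (h : Eucl d → ℂ) : Set (Eucl d) :=
  {x | ∀ U : Set (Eucl d), IsOpen U → x ∈ U → ¬ ∀ᵐ y, y ∈ U → h y = 0}

/-- The family `𝓔` of closed subsets of the dual group of Haar measure zero (blind spots). -/
structure IsBlindSpot {d : ℕ} (E : Set (Eucl d)) : Prop where
  isClosed : IsClosed E
  null : volume E = 0

/-- The space `𝓓_E` of all `f ∈ L²` whose Fourier-Plancherel transform is essentially bounded and
has a compact support which is disjoint from `E`. -/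
def dSpace {d : ℕ} (E : Set (Eucl d)) : Set (L2 d) :=
  {f | MemLp (hat f) ∞ ∧
    IsCompact (essSupp (hat f)) ∧
    essSupp (hat f) ⊆ Eᶜ}

/-! ### Annihilators and covolumes -/

/-- The annihilator `Γ^⊥ = {ω | exp (2 π i ⟪x, ω⟫) = 1 for all x ∈ Γ}`. -/
def annihilator {d : ℕ} (Γ : AddSubgroup (Eucl d)) : Set (Eucl d) :=
  {ω | ∀ x ∈ Γ, Real.fourierChar ⟪x, ω⟫ = 1}

/-- Weil's integral formula: the measure `ν` on `ℝᵈ ⧸ Γ` is canonically related to Lebesgue measure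
on `ℝᵈ` and to the Haar measure `μ` on `Γ`.  The inner integral depends only on the coset `q`, by
invariance of `μ`. -/
def WeilFormula {d : ℕ} (Γ : AddSubgroup (Eucl d)) (μ : Measure Γ)
    (ν : Measure (Eucl d ⧸ Γ)) : Prop :=
  ∀ f : Eucl d → ℝ≥0∞, Measurable f →
    ∫⁻ x, f x = ∫⁻ q, ∫⁻ γ : Γ, f (q.out + (γ : Eucl d)) ∂μ ∂ν

open Classical in
/-- The quotient measure on `ℝᵈ ⧸ Γ`, i.e. the measure determined by Weil's integral formula (it
exists and is unique when `Γ` is closed and `μ` is a Haar measure on `Γ`). -/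
def quotientMeasure {d : ℕ} (Γ : AddSubgroup (Eucl d)) (μ : Measure Γ) : Measure (Eucl d ⧸ Γ) :=
  if h : ∃ ν, WeilFormula Γ μ ν then h.choose else 0

/-- The covolume of `Γ`: the total mass of the quotient measure. -/
def covol {d : ℕ} (Γ : AddSubgroup (Eucl d)) (μ : Measure Γ) : ℝ≥0∞ :=
  quotientMeasure Γ μ univ

/-! ### Generalised translation-invariant systems -/

/-- The data of a generalised translation-invariant system
`⋃_j {g_{j,p} (· - γ) : γ ∈ Γ_j, p ∈ P}` in `L²(ℝᵈ)`: closed co-compact subgroups `Γ_j`, each with a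
chosen Haar measure, and generators `g_{j,p} ∈ L²(ℝᵈ)`.  The set `P` is (here) finite and carries
the counting measure. -/
structure GTISystem (d : ℕ) (J P : Type*) where
  /-- the translation subgroups -/
  Γ : J → AddSubgroup (Eucl d)
  isClosed : ∀ j, IsClosed (Γ j : Set (Eucl d))
  compactQuotient : ∀ j, CompactSpace (Eucl d ⧸ Γ j)
  /-- the Haar measures on the translation subgroups -/
  haar : ∀ j, Measure (Γ j)
  isHaar : ∀ j, (haar j).IsAddHaarMeasure
  /-- the generating functions -/
  gen : J → P → L2 d

/-- The local integrability condition with respect to `E`. -/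
def GTISystem.LIC {d : ℕ} {J P : Type*} [Fintype P] (S : GTISystem d J P)
    (E : Set (Eucl d)) : Prop :=
  ∀ f ∈ dSpace E,
    ∑' j, (covol (S.Γ j) (S.haar j))⁻¹ * ∑ p, ∑' α : annihilator (S.Γ j),
      ∫⁻ ω in essSupp (hat f),
        ‖hat f (ω + (α : Eucl d)) *
          hat (S.gen j p) ω‖ₑ ^ 2 < ∞

/-- The Calderón sum `ω ↦ ∑_j covol(Γ_j)⁻¹ ∑_p |ĝ_{j,p}(ω)|²`. -/
def GTISystem.calderonSum {d : ℕ} {J P : Type*} [Fintype P] (S : GTISystem d J P)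
    (ω : Eucl d) : ℝ≥0∞ :=
  ∑' j, (covol (S.Γ j) (S.haar j))⁻¹ *
    ∑ p, ‖hat (S.gen j p) ω‖ₑ ^ 2

/-- The Calderón integrability condition with respect to `E`: the Calderón sum is locally integrable
on the complement of `E`, i.e. it has a finite integral over each compact subset. -/
def GTISystem.CalderonIntegrable {d : ℕ} {J P : Type*} [Fintype P] (S : GTISystem d J P)
    (E : Set (Eucl d)) : Prop :=
  ∀ K : Set (Eucl d), IsCompact K → K ⊆ Eᶜ → ∫⁻ ω in K, S.calderonSum ω < ∞

/-! ### Matrices expanding on a subspace -/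

/-- The real matrix `A`, acting on `ℂᵈ`. -/
def complexify {d : ℕ} (A : Matrix (Fin d) (Fin d) ℝ) : Module.End ℂ (Fin d → ℂ) :=
  Matrix.toLin' (A.map Complex.ofReal)

/-- `A` is expanding on a subspace: all (complex) eigenvalues have modulus at least one, some
eigenvalue has modulus larger than one, and the eigenvalues of modulus one have only Jordan blocks
of order one, i.e. their generalised eigenspaces are eigenspaces. -/
structure ExpandingOnSubspace {d : ℕ} (A : GL (Fin d) ℝ) : Prop where
  one_le : ∀ z : ℂ, (complexify (A : Matrix (Fin d) (Fin d) ℝ)).HasEigenvalue z → 1 ≤ ‖z‖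
  exists_one_lt :
    ∃ z : ℂ, (complexify (A : Matrix (Fin d) (Fin d) ℝ)).HasEigenvalue z ∧ 1 < ‖z‖
  jordan : ∀ z : ℂ, (complexify (A : Matrix (Fin d) (Fin d) ℝ)).HasEigenvalue z → ‖z‖ = 1 →
    (complexify (A : Matrix (Fin d) (Fin d) ℝ)).maxGenEigenspace z =
      (complexify (A : Matrix (Fin d) (Fin d) ℝ)).eigenspace z

/-- The set of real vectors in the complex span of the eigenvectors of the transpose `Aᵀ` to
eigenvalues of modulus one. -/
def neutralSubspace {d : ℕ} (A : GL (Fin d) ℝ) : Set (Eucl d) :=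
  {ω | (fun i => ((ω i : ℝ) : ℂ)) ∈ ⨆ z ∈ {z : ℂ | ‖z‖ = 1},
    (complexify (A : Matrix (Fin d) (Fin d) ℝ).transpose).eigenspace z}

/-! ### Wavelet systems -/

/-- The action of `B ∈ GL(d, ℝ)` on `ℝᵈ`. -/
def glEquiv {d : ℕ} (B : GL (Fin d) ℝ) : Eucl d ≃L[ℝ] Eucl d :=
  ContinuousLinearEquiv.unitsEquiv ℝ (Eucl d)
    (Units.map (Matrix.toEuclideanCLM (n := Fin d) (𝕜 := ℝ) : _ →* _) B)

theorem glEquiv_apply {d : ℕ} (B : GL (Fin d) ℝ) (x : Eucl d) :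
    glEquiv B x = Matrix.toEuclideanLin (B : Matrix (Fin d) (Fin d) ℝ) x := rfl

/-- The function `|det B|^{1/2} g(B ·)`. -/
def dilationFun {d : ℕ} (B : GL (Fin d) ℝ) (g : Eucl d → ℂ) (x : Eucl d) : ℂ :=
  ((|(B : Matrix (Fin d) (Fin d) ℝ).det| ^ (1 / 2 : ℝ) : ℝ) : ℂ) * g (glEquiv B x)

theorem memLp_dilationFun {d : ℕ} (B : GL (Fin d) ℝ) (g : L2 d) :
    MemLp (dilationFun B g) 2 := by
  have hdet : LinearMap.det ((glEquiv B).toLinearEquiv : Eucl d →ₗ[ℝ] Eucl d) ≠ 0 :=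
    (LinearEquiv.isUnit_det' _).ne_zero
  have hmap := Measure.map_linearMap_addHaar_eq_smul_addHaar (volume : Measure (Eucl d)) hdet
  have h : MemLp (g : Eucl d → ℂ) 2 (Measure.map (glEquiv B) volume) := by
    have h2 := (Lp.memLp g).smul_measure (c := ENNReal.ofReal
      |(LinearMap.det ((glEquiv B).toLinearEquiv : Eucl d →ₗ[ℝ] Eucl d))⁻¹|)
      ENNReal.ofReal_ne_top
    rw [← hmap] at h2
    exact h2
  exact (h.comp_of_map (glEquiv B).continuous.aemeasurable).const_mul _

/-- The dilation operator `D_B g = |det B|^{1/2} g(B ·)` on `L²(ℝᵈ)`. -/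
def dilation {d : ℕ} (B : GL (Fin d) ℝ) (g : L2 d) : L2 d :=
  (memLp_dilationFun B g).toLp

/-- The subgroup `B Γ`. -/
def imageSubgroup {d : ℕ} (B : GL (Fin d) ℝ) (Γ : AddSubgroup (Eucl d)) :
    AddSubgroup (Eucl d) :=
  Γ.map ((glEquiv B).toLinearEquiv.toAddEquiv : Eucl d →+ Eucl d)

/-- The isomorphism `Γ ≃ B Γ`, `γ ↦ B γ`. -/
def imageEquiv {d : ℕ} (B : GL (Fin d) ℝ) (Γ : AddSubgroup (Eucl d)) :
    Γ ≃+ imageSubgroup B Γ :=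
  AddEquiv.addSubgroupMap (glEquiv B).toLinearEquiv.toAddEquiv Γ

theorem isClosed_imageSubgroup {d : ℕ} (B : GL (Fin d) ℝ) {Γ : AddSubgroup (Eucl d)}
    (h : IsClosed (Γ : Set (Eucl d))) : IsClosed (imageSubgroup B Γ : Set (Eucl d)) :=
  (glEquiv B).toHomeomorph.isClosedMap _ h

theorem compactSpace_imageSubgroup {d : ℕ} (B : GL (Fin d) ℝ) {Γ : AddSubgroup (Eucl d)}
    (h : CompactSpace (Eucl d ⧸ Γ)) : CompactSpace (Eucl d ⧸ imageSubgroup B Γ) := by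
  let f : Eucl d ⧸ Γ → Eucl d ⧸ imageSubgroup B Γ :=
    QuotientAddGroup.map Γ (imageSubgroup B Γ)
      ((glEquiv B).toLinearEquiv.toAddEquiv : Eucl d →+ Eucl d) (AddSubgroup.le_comap_map _ _)
  have hf : Continuous f :=
    continuous_quot_lift _ (continuous_quot_mk.comp (glEquiv B).continuous)
  have hs : Function.Surjective f := by
    intro q
    obtain ⟨y, rfl⟩ := QuotientAddGroup.mk_surjective q
    refine ⟨((glEquiv B).symm y : Eucl d), ?_⟩
    change ((glEquiv B ((glEquiv B).symm y) : Eucl d) : Eucl d ⧸ imageSubgroup B Γ) = _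
    rw [ContinuousLinearEquiv.apply_symm_apply]
  exact hs.compactSpace hf

theorem isAddHaarMeasure_imageSubgroup {d : ℕ} (B : GL (Fin d) ℝ) {Γ : AddSubgroup (Eucl d)}
    (μ : Measure Γ) (h : μ.IsAddHaarMeasure) : (μ.map (imageEquiv B Γ)).IsAddHaarMeasure := by
  refine AddEquiv.isAddHaarMeasure_map μ (imageEquiv B Γ) ?_ ?_
  · exact Continuous.subtype_mk ((glEquiv B).continuous.comp continuous_subtype_val) _
  · exact Continuous.subtype_mk ((glEquiv B).symm.continuous.comp continuous_subtype_val) _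

/-- The wavelet system `⋃_{j ∈ ℤ} {T_γ D_{A^j} g_p : γ ∈ A^{-j} Γ, p ∈ P}`.  The subgroup `A^{-j} Γ`
carries the image under `A^{-j}` of the given Haar measure `μ` on `Γ`. -/
def waveletSystem {d : ℕ} {P : Type*} (A : GL (Fin d) ℝ) (Γ : AddSubgroup (Eucl d))
    (hΓ : IsClosed (Γ : Set (Eucl d))) (hc : CompactSpace (Eucl d ⧸ Γ))
    (μ : Measure Γ) (hμ : μ.IsAddHaarMeasure) (g : P → L2 d) :
    GTISystem d ℤ P where
  Γ j := imageSubgroup (A ^ (-j)) Γ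
  isClosed j := isClosed_imageSubgroup (A ^ (-j)) hΓ
  compactQuotient j := compactSpace_imageSubgroup (A ^ (-j)) hc
  haar j := μ.map (imageEquiv (A ^ (-j)) Γ)
  isHaar j := isAddHaarMeasure_imageSubgroup (A ^ (-j)) μ hμ
  gen j p := dilation (A ^ j) (g p)

end

/-! The LIC yields the Calderón condition by testing it on `f` with `hat f` the indicator of `K` and
keeping only the summand `α = 0` (`GTISystem.LIC.calderonIntegrable`); this uses nothing about `A`.

For the converse, let `hat f` be bounded by `M`, with support `K` in the ball of radius `R`. Only
`α` with `‖α‖ ≤ 2R` contribute, so the `j`-th term of the LIC is at most `M² n_j w_j I_j`, where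
`w_j = covol(Γ_j)⁻¹`, `n_j` counts the points of `Γ_j^⊥` in the ball of radius `2R`, and `I_j = ∑_p
∫_K |ĝ_{j,p}|²`. Two facts finish the estimate.

Counting (`exists_encard_annihilator_le`): `n_j w_j ≤ N (w_j + c)` with `c = covol(Γ)⁻¹`. Indeed
`Γ_j^⊥` is the image under `(Aᵀ)^j` of a uniformly separated set, and the powers `Q^m`, `m ≥ 0`, of
`Q = (A⁻¹)ᵀ` are uniformly bounded, so a volume packing argument applies. The LIC sum is then at
most `M² N (∑ w_j I_j + c ∑ I_j)`, and `∑ w_j I_j` is the Calderón integral over `K`.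

No return (`ExpandingOnSubspace.exists_forall_glEquiv_pow_notMem`): a change of variables turns
`I_j` into the integral of `∑_p |ĝ_p|²` over `Q^j K`. As `K` avoids the neutral subspace, to which
forward `Q`-orbits converge uniformly on `K`, the sets `Q^j K` overlap boundedly often, and `∑ I_j`
is finite by Plancherel.

Finally, the neutral subspace is proper, hence closed and null, so it may be adjoined to any blind
spot. -/

/-! ### Powers on generalised eigenvectors; Jordan blocks of the transpose -/

/-- Induction on the order `k` of the generalised eigenvector: `T v = u + z v` with `u` of lower
order gives `S^(n+1) v = z⁻¹ (S^n v - S^(n+1) u)`. Any rate `ρ > ‖z‖⁻¹` absorbs the polynomial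
factor coming from the Jordan block. -/
theorem exists_norm_pow_apply_le_of_ker_pow {V : Type*} [NormedAddCommGroup V] [NormedSpace ℂ V]
    {S T : Module.End ℂ V} (hST : ∀ v, S (T v) = v) {z : ℂ} {ρ : ℝ} (hρ : ‖z‖⁻¹ < ρ)
    (hz : z ≠ 0) (k : ℕ) (v : V) (hv : ((T - algebraMap ℂ _ z) ^ k) v = 0) :
    ∃ C : ℝ, ∀ n : ℕ, ‖(S ^ n) v‖ ≤ C * ρ ^ n := by
  have hz' : 0 < ‖z‖⁻¹ := by positivity
  induction k generalizing v with
  | zero =>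
    refine ⟨0, fun n => ?_⟩
    have : v = 0 := by simpa using hv
    simp [this]
  | succ k ih =>
    set u := (T - algebraMap ℂ _ z) v with hu
    obtain ⟨C', hC'⟩ := ih u (by rw [pow_succ] at hv; exact hv)
    have hTv : T v = u + z • v := by
      simp [hu]
    have hSv : S v = z⁻¹ • (v - S u) := by
      have h1 : v = S u + z • S v := by
        conv_lhs => rw [← hST v, hTv]
        simp
      have h2 : v - S u = z • S v := by
        rw [sub_eq_iff_eq_add']; exact h1
      rw [h2, smul_smul, inv_mul_cancel₀ hz, one_smul]
    have hrec : ∀ n : ℕ, (S ^ (n + 1)) v = z⁻¹ • ((S ^ n) v - (S ^ (n + 1)) u) := by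
      intro n
      rw [pow_succ, Module.End.mul_apply, Module.End.mul_apply, hSv]
      simp
    set r := ‖z‖⁻¹ with hr
    have hρ0 : 0 < ρ := hz'.trans hρ
    have hC0 : 0 ≤ C' := by
      have := (norm_nonneg _).trans (hC' 0)
      simpa using this
    -- The term `‖v‖` covers `n = 0`; the fraction is the solution `C` of `r (C + C' ρ) = C ρ`,
    -- which is what the recursion needs to preserve the bound.
    refine ⟨‖v‖ + r * (C' * ρ) / (ρ - r), fun n => ?_⟩
    have hpos : 0 < ρ - r := sub_pos.2 hρ
    set C := ‖v‖ + r * (C' * ρ) / (ρ - r) with hC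
    have hkey : r * (C + C' * ρ) ≤ C * ρ := by
      have : r * (C' * ρ) / (ρ - r) ≤ C := by
        rw [hC]; linarith [norm_nonneg v]
      rw [div_le_iff₀ hpos] at this
      linarith
    induction n with
    | zero =>
      have : 0 ≤ r * (C' * ρ) / (ρ - r) := by positivity
      simp only [pow_zero, Module.End.one_apply, mul_one]
      linarith
    | succ n ihn =>
      rw [hrec, norm_smul, norm_inv]
      calc r * ‖(S ^ n) v - (S ^ (n + 1)) u‖
          ≤ r * (C * ρ ^ n + C' * ρ ^ (n + 1)) := by
            gcongr
            exact (norm_sub_le _ _).trans (add_le_add ihn (hC' _))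
        _ = r * (C + C' * ρ) * ρ ^ n := by ring
        _ ≤ C * ρ * ρ ^ n := by gcongr
        _ = C * ρ ^ (n + 1) := by ring

theorem norm_pow_apply_of_mem_eigenspace {V : Type*} [NormedAddCommGroup V] [NormedSpace ℂ V]
    {S T : Module.End ℂ V} (hST : ∀ v, S (T v) = v) {z : ℂ} (hz : ‖z‖ = 1) {v : V}
    (hv : v ∈ T.eigenspace z) (n : ℕ) : (S ^ n) v = (z⁻¹) ^ n • v := by
  have hz0 : z ≠ 0 := by rintro rfl; simp at hz
  have hSv : S v = z⁻¹ • v := by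
    have h1 := hST v
    rw [Module.End.mem_eigenspace_iff.1 hv, map_smul] at h1
    conv_rhs => rw [← h1, smul_smul, inv_mul_cancel₀ hz0, one_smul]
  induction n with
  | zero => simp
  | succ n ih => rw [pow_succ, Module.End.mul_apply, hSv, map_smul, ih, smul_smul, pow_succ']

/-- The hypothesis says `rank M² = rank M`. Rank is invariant under transposition, so the kernels of
`Mᵀ` and `(Mᵀ)²`, one contained in the other, have equal dimension. -/
theorem ker_transpose_of_ker {n K : Type*} [Fintype n] [DecidableEq n] [Field K]
    (M : Matrix n n K) (h : ∀ v, M.toLin' (M.toLin' v) = 0 → M.toLin' v = 0) (v : n → K)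
    (hv : M.transpose.toLin' (M.transpose.toLin' v) = 0) : M.transpose.toLin' v = 0 := by
  have hr : ∀ N : Matrix n n K, N.rank = Module.finrank K (LinearMap.range N.toLin') := fun N => rfl
  have hrank : (M * M).rank = M.rank := by
    have hk : LinearMap.ker (M * M).toLin' = LinearMap.ker M.toLin' := by
      ext v
      simp only [LinearMap.mem_ker, Matrix.toLin'_mul, LinearMap.comp_apply]
      exact ⟨h v, fun hv => by rw [hv, map_zero]⟩
    have h1 := (M * M).toLin'.finrank_range_add_finrank_ker
    have h2 := M.toLin'.finrank_range_add_finrank_ker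
    rw [hk] at h1
    rw [hr, hr]
    omega
  have hrank' : (M.transpose * M.transpose).rank = M.transpose.rank := by
    rw [← Matrix.transpose_mul, Matrix.rank_transpose, Matrix.rank_transpose, hrank]
  have hk : LinearMap.ker M.transpose.toLin' =
      LinearMap.ker (M.transpose * M.transpose).toLin' := by
    apply Submodule.eq_of_le_of_finrank_eq
    · intro w hw
      simp only [LinearMap.mem_ker, Matrix.toLin'_mul, LinearMap.comp_apply] at hw ⊢
      rw [hw, map_zero]
    · have h1 := (M.transpose * M.transpose).toLin'.finrank_range_add_finrank_ker
      have h2 := M.transpose.toLin'.finrank_range_add_finrank_ker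
      rw [hr, hr] at hrank'
      omega
  have : v ∈ LinearMap.ker (M.transpose * M.transpose).toLin' := by
    simpa [Matrix.toLin'_mul] using hv
  rw [← hk] at this
  exact this

theorem apply_eq_zero_of_pow_apply_eq_zero {V : Type*} [AddCommGroup V] [Module ℂ V]
    {N : Module.End ℂ V} (h : ∀ v, N (N v) = 0 → N v = 0) (k : ℕ) (v : V)
    (hv : (N ^ k) v = 0) : N v = 0 := by
  induction k generalizing v with
  | zero => have : v = 0 := by simpa using hv
            simp [this]
  | succ k ih => exact h v (ih (N v) (by rw [pow_succ] at hv; exact hv))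

/-! ### Orbits of the contragredient and the neutral subspace -/

section

variable {d : ℕ}

theorem hasEigenvalue_complexify_transpose (M : Matrix (Fin d) (Fin d) ℝ) (z : ℂ) :
    (complexify M.transpose).HasEigenvalue z ↔ (complexify M).HasEigenvalue z := by
  simp only [complexify, Module.End.hasEigenvalue_iff_isRoot_charpoly, Matrix.charpoly_toLin']
  rw [Matrix.transpose_map, Matrix.charpoly_transpose]

/-- Carries the Jordan block condition from `A` to `Aᵀ`, the matrix acting on the frequency side. -/
theorem ExpandingOnSubspace.eigenspace_transpose {A : GL (Fin d) ℝ} (hA : ExpandingOnSubspace A)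
    {z : ℂ} (hz : ‖z‖ = 1) :
    (complexify (A : Matrix (Fin d) (Fin d) ℝ).transpose).maxGenEigenspace z ≤
      (complexify (A : Matrix (Fin d) (Fin d) ℝ).transpose).eigenspace z := by
  set M : Matrix (Fin d) (Fin d) ℂ :=
    (A : Matrix (Fin d) (Fin d) ℝ).map Complex.ofReal - algebraMap ℂ _ z with hM
  have e1 : M.toLin' = complexify (A : Matrix (Fin d) (Fin d) ℝ) - algebraMap ℂ _ z := by
    rw [hM, map_sub, complexify]
    congr 1
    rw [Algebra.algebraMap_eq_smul_one, Algebra.algebraMap_eq_smul_one]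
    simp [Module.End.one_eq_id]
  have e2 : M.transpose.toLin' =
      complexify (A : Matrix (Fin d) (Fin d) ℝ).transpose - algebraMap ℂ _ z := by
    rw [hM, Matrix.transpose_sub, map_sub, complexify, Matrix.transpose_map]
    congr 1
    rw [Algebra.algebraMap_eq_smul_one, Algebra.algebraMap_eq_smul_one]
    simp [Module.End.one_eq_id]
  have h1 : ∀ v, M.toLin' (M.toLin' v) = 0 → M.toLin' v = 0 := by
    intro v hv
    by_contra hne
    rw [e1] at hv hne
    have hmem : (complexify (A : Matrix (Fin d) (Fin d) ℝ) - algebraMap ℂ _ z) v ∈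
        (complexify (A : Matrix (Fin d) (Fin d) ℝ)).eigenspace z := by
      rw [Module.End.eigenspace_def]; exact hv
    have hev := Module.End.hasEigenvalue_of_hasEigenvector
      (f := complexify (A : Matrix (Fin d) (Fin d) ℝ)) ⟨hmem, hne⟩
    have hv2 : v ∈ (complexify (A : Matrix (Fin d) (Fin d) ℝ)).maxGenEigenspace z := by
      rw [Module.End.mem_maxGenEigenspace]
      exact ⟨2, by rw [pow_two]; exact hv⟩
    rw [hA.jordan z hev hz, Module.End.eigenspace_def] at hv2
    exact hne hv2
  intro v hv
  rw [Module.End.mem_maxGenEigenspace] at hv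
  obtain ⟨k, hk⟩ := hv
  rw [Module.End.eigenspace_def]
  have h2 := ker_transpose_of_ker M h1
  rw [e2] at h2
  exact apply_eq_zero_of_pow_apply_eq_zero h2 k v hk

/-- The contragredient `A ↦ (A⁻¹)ᵀ`. -/
def contragredient : GL (Fin d) ℝ →* GL (Fin d) ℝ where
  toFun A := ⟨(A⁻¹ : GL (Fin d) ℝ).val.transpose, A.val.transpose,
    by rw [← Matrix.transpose_mul, ← Units.val_mul]; simp,
    by rw [← Matrix.transpose_mul, ← Units.val_mul]; simp⟩
  map_one' := by apply Units.ext; simp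
  map_mul' A B := by
    apply Units.ext
    simp only [Units.val_mul]
    rw [← Matrix.transpose_mul, ← Units.val_mul, mul_inv_rev]

theorem coe_contragredient (A : GL (Fin d) ℝ) :
    (contragredient A : Matrix (Fin d) (Fin d) ℝ) = (A⁻¹ : GL (Fin d) ℝ).val.transpose := rfl

theorem glEquiv_mul_apply (A B : GL (Fin d) ℝ) (x : Eucl d) :
    glEquiv (A * B) x = glEquiv A (glEquiv B x) := by
  simp [glEquiv_apply, Matrix.toLpLin_apply]

theorem glEquiv_one_apply (x : Eucl d) : glEquiv (1 : GL (Fin d) ℝ) x = x := by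
  simp [glEquiv_apply]

theorem glEquiv_inv_apply_apply (A : GL (Fin d) ℝ) (x : Eucl d) :
    glEquiv A⁻¹ (glEquiv A x) = x := by
  rw [← glEquiv_mul_apply, inv_mul_cancel, glEquiv_one_apply]

/-- The inclusion `ℝᵈ → ℂᵈ`. -/
def complexEmb (d : ℕ) : Eucl d →ₗ[ℝ] (Fin d → ℂ) where
  toFun x i := (x i : ℂ)
  map_add' x y := by ext; simp
  map_smul' c x := by ext; simp

theorem complexEmb_apply (x : Eucl d) (i : Fin d) : complexEmb d x i = (x i : ℂ) := rfl

theorem complexEmb_injective : Function.Injective (complexEmb d) := by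
  intro x y h
  ext i
  exact Complex.ofReal_injective (congrFun h i)

theorem continuous_complexEmb : Continuous (complexEmb d) :=
  LinearMap.continuous_of_finiteDimensional _

theorem complexEmb_glEquiv (Q : GL (Fin d) ℝ) (x : Eucl d) :
    complexEmb d (glEquiv Q x) = complexify (Q : Matrix (Fin d) (Fin d) ℝ) (complexEmb d x) := by
  ext i
  simp [complexEmb_apply, glEquiv_apply, complexify, Matrix.mulVec, dotProduct]

theorem complexEmb_glEquiv_pow (Q : GL (Fin d) ℝ) (k : ℕ) (x : Eucl d) :
    complexEmb d (glEquiv (Q ^ k) x) =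
      (complexify (Q : Matrix (Fin d) (Fin d) ℝ) ^ k) (complexEmb d x) := by
  induction k generalizing x with
  | zero => simp [glEquiv_one_apply]
  | succ k ih => rw [pow_succ, glEquiv_mul_apply, ih, complexEmb_glEquiv, pow_succ]; rfl

theorem complexify_contragredient_apply (A : GL (Fin d) ℝ) (v : Fin d → ℂ) :
    complexify (contragredient A : Matrix (Fin d) (Fin d) ℝ)
      (complexify (A : Matrix (Fin d) (Fin d) ℝ).transpose v) = v := by
  have h : (contragredient A : Matrix (Fin d) (Fin d) ℝ) *
      (A : Matrix (Fin d) (Fin d) ℝ).transpose = 1 := by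
    rw [coe_contragredient, ← Matrix.transpose_mul, ← Units.val_mul]; simp
  have h2 : (contragredient A : Matrix (Fin d) (Fin d) ℝ).map Complex.ofReal *
      (A : Matrix (Fin d) (Fin d) ℝ).transpose.map Complex.ofReal = 1 := by
    have h3 := congrArg (fun M => (Complex.ofRealHom.mapMatrix : Matrix (Fin d) (Fin d) ℝ →+* _) M) h
    simp only [map_mul, map_one] at h3
    exact h3
  rw [complexify, complexify, ← LinearMap.comp_apply, ← Matrix.toLin'_mul, h2, Matrix.toLin'_one]
  rfl

/-- The complex span of the eigenvectors of `Aᵀ` with eigenvalues of modulus one. -/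
def neutralComplex (A : GL (Fin d) ℝ) : Submodule ℂ (Fin d → ℂ) :=
  ⨆ z ∈ {z : ℂ | ‖z‖ = 1}, (complexify (A : Matrix (Fin d) (Fin d) ℝ).transpose).eigenspace z

theorem mem_neutralSubspace_iff (A : GL (Fin d) ℝ) (x : Eucl d) :
    x ∈ neutralSubspace A ↔ complexEmb d x ∈ neutralComplex A := Iff.rfl

/-- Generalised eigenvectors of `Aᵀ` span. Those with `‖z‖ = 1` are true eigenvectors, hence
neutral; those with `‖z‖ > 1` decay geometrically under the inverse of `Aᵀ`. -/
theorem ExpandingOnSubspace.induction {A : GL (Fin d) ℝ} (hA : ExpandingOnSubspace A)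
    (W : Submodule ℂ (Fin d → ℂ))
    (h1 : ∀ v ∈ neutralComplex A, v ∈ W)
    (h2 : ∀ v, Filter.Tendsto
      (fun n => (complexify (contragredient A : Matrix (Fin d) (Fin d) ℝ) ^ n) v) Filter.atTop
        (nhds 0) → v ∈ W) : W = ⊤ := by
  rw [eq_top_iff, ← Module.End.iSup_maxGenEigenspace_eq_top
    (complexify (A : Matrix (Fin d) (Fin d) ℝ).transpose)]
  refine iSup_le fun z v hv => ?_
  by_cases hv0 : v = 0
  · rw [hv0]; exact W.zero_mem
  have hev : (complexify (A : Matrix (Fin d) (Fin d) ℝ).transpose).HasEigenvalue z := by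
    rw [Module.End.mem_maxGenEigenspace] at hv
    obtain ⟨k, hk⟩ := hv
    refine Module.End.hasEigenvalue_of_hasGenEigenvalue (k := k) fun h => hv0 ?_
    rw [← Submodule.mem_bot ℂ, ← h, Module.End.mem_genEigenspace_nat]
    exact hk
  have hz := hA.one_le z ((hasEigenvalue_complexify_transpose _ _).1 hev)
  rcases hz.eq_or_lt with hz | hz
  · refine h1 v ?_
    exact Submodule.mem_iSup_of_mem z (Submodule.mem_iSup_of_mem hz.symm
      (hA.eigenspace_transpose hz.symm hv))
  · rw [Module.End.mem_maxGenEigenspace] at hv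
    obtain ⟨k, hk⟩ := hv
    obtain ⟨ρ, hρ1, hρ2⟩ := exists_between (inv_lt_one_of_one_lt₀ hz)
    obtain ⟨C, hC⟩ := exists_norm_pow_apply_le_of_ker_pow (complexify_contragredient_apply A) hρ1
      (by rintro rfl; simp at hz; linarith) k v hk
    refine h2 v (squeeze_zero_norm hC ?_)
    have hρ0 : 0 ≤ ρ := (by positivity : 0 ≤ ‖z‖⁻¹).trans hρ1.le
    simpa using (tendsto_pow_atTop_nhds_zero_of_lt_one hρ0 hρ2).const_mul C

/-- The vectors with a bounded forward orbit. -/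
def boundedOrbit {V : Type*} [SeminormedAddCommGroup V] [NormedSpace ℂ V] (F : Module.End ℂ V) :
    Submodule ℂ V where
  carrier := {v | ∃ C, ∀ n : ℕ, ‖(F ^ n) v‖ ≤ C}
  add_mem' := by
    rintro v w ⟨C, hC⟩ ⟨D, hD⟩
    exact ⟨C + D, fun n => by
      rw [map_add]; exact (norm_add_le _ _).trans (add_le_add (hC n) (hD n))⟩
  zero_mem' := ⟨0, fun n => by simp⟩
  smul_mem' := by
    rintro c v ⟨C, hC⟩
    exact ⟨‖c‖ * C, fun n => by rw [map_smul, norm_smul]; gcongr; exact hC n⟩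

theorem neutralComplex_le_boundedOrbit (A : GL (Fin d) ℝ) : neutralComplex A ≤
    boundedOrbit (complexify (contragredient A : Matrix (Fin d) (Fin d) ℝ)) := by
  refine iSup₂_le fun z hz v hv => ⟨‖v‖, fun n => ?_⟩
  rw [norm_pow_apply_of_mem_eigenspace (complexify_contragredient_apply A) hz hv, norm_smul]
  have hz' : ‖z‖ = 1 := hz
  simp [hz']

theorem eigenvector_pow_apply {V : Type*} [AddCommGroup V] [Module ℂ V]
    {T : Module.End ℂ V} {z : ℂ} {v : V}
    (hv : v ∈ T.eigenspace z) (n : ℕ) : (T ^ n) v = z ^ n • v := by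
  induction n with
  | zero => simp
  | succ n ih =>
    rw [pow_succ, Module.End.mul_apply, Module.End.mem_eigenspace_iff.1 hv, map_smul, ih,
      smul_smul, pow_succ']

theorem neutralComplex_le_boundedOrbit_transpose (A : GL (Fin d) ℝ) : neutralComplex A ≤
    boundedOrbit (complexify (A : Matrix (Fin d) (Fin d) ℝ).transpose) := by
  refine iSup₂_le fun z hz v hv => ⟨‖v‖, fun n => ?_⟩
  have hz' : ‖z‖ = 1 := hz
  rw [eigenvector_pow_apply hv, norm_smul]
  simp [hz']

theorem ExpandingOnSubspace.exists_norm_pow_apply_le {A : GL (Fin d) ℝ}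
    (hA : ExpandingOnSubspace A) (v : Fin d → ℂ) : ∃ C, ∀ n : ℕ,
      ‖(complexify (contragredient A : Matrix (Fin d) (Fin d) ℝ) ^ n) v‖ ≤ C := by
  have := hA.induction
    (boundedOrbit (complexify (contragredient A : Matrix (Fin d) (Fin d) ℝ)))
    (neutralComplex_le_boundedOrbit A) (by
      intro v hv
      obtain ⟨C, hC⟩ := hv.norm.bddAbove_range
      exact ⟨C, fun n => hC ⟨n, rfl⟩⟩)
  exact (this ▸ Submodule.mem_top :
    v ∈ boundedOrbit (complexify (contragredient A : Matrix (Fin d) (Fin d) ℝ)))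

theorem ExpandingOnSubspace.exists_norm_glEquiv_pow_le {A : GL (Fin d) ℝ}
    (hA : ExpandingOnSubspace A) : ∃ C : ℝ, 0 ≤ C ∧ ∀ (n : ℕ) (x : Eucl d),
      ‖glEquiv (contragredient A ^ n) x‖ ≤ C * ‖x‖ := by
  obtain ⟨K, -, hK⟩ := (complexEmb d).exists_antilipschitzWith
    (LinearMap.ker_eq_bot.2 complexEmb_injective)
  obtain ⟨C, hC⟩ := banach_steinhaus
    (g := fun n : ℕ => ((glEquiv (contragredient A ^ n)) : Eucl d →L[ℝ] Eucl d)) (by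
      intro x
      obtain ⟨C, hC⟩ := hA.exists_norm_pow_apply_le (complexEmb d x)
      refine ⟨K * C, fun n => ?_⟩
      have h := hK.le_mul_dist (glEquiv (contragredient A ^ n) x) 0
      rw [map_zero, dist_zero_right, dist_zero_right, complexEmb_glEquiv_pow] at h
      exact h.trans (mul_le_mul_of_nonneg_left (hC n) K.2))
  exact ⟨C, (norm_nonneg _).trans (hC 0), fun n x => ContinuousLinearMap.le_of_opNorm_le _ (hC n) x⟩

/-- The quotient norm measures the distance to the neutral space: neutral vectors stay in it
forever, and the remaining generalised eigenvectors tend to zero. -/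
theorem ExpandingOnSubspace.tendsto_mkQ {A : GL (Fin d) ℝ}
    (hA : ExpandingOnSubspace A) (v : Fin d → ℂ) : Filter.Tendsto (fun n : ℕ =>
      ‖(neutralComplex A).mkQ ((complexify (contragredient A : Matrix (Fin d) (Fin d) ℝ) ^ n) v)‖)
      Filter.atTop (nhds 0) := by
  let W : Submodule ℂ (Fin d → ℂ) :=
    { carrier := {v | Filter.Tendsto (fun n : ℕ => ‖(neutralComplex A).mkQ
        ((complexify (contragredient A : Matrix (Fin d) (Fin d) ℝ) ^ n) v)‖)
        Filter.atTop (nhds 0)}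
      add_mem' := by
        intro v w hv hw
        refine squeeze_zero (fun _ => norm_nonneg _) (fun n => ?_) (by simpa using hv.add hw)
        rw [map_add, map_add]; exact norm_add_le _ _
      zero_mem' := by simp
      smul_mem' := by
        intro c v hv
        refine squeeze_zero (fun _ => norm_nonneg _) (fun n => ?_) (by simpa only [mul_zero] using hv.const_mul ‖c‖)
        rw [map_smul, map_smul, norm_smul] }
  have hmk : ∀ w : Fin d → ℂ, ‖(neutralComplex A).mkQ w‖ ≤ ‖w‖ := fun w =>
    Submodule.Quotient.norm_mk_le _ w
  have : W = ⊤ := hA.induction W (by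
    intro v hv
    have h0 : ∀ n : ℕ, (complexify (contragredient A : Matrix (Fin d) (Fin d) ℝ) ^ n) v ∈
        neutralComplex A := by
      intro n
      suffices h : neutralComplex A ≤ (neutralComplex A).comap
          (complexify (contragredient A : Matrix (Fin d) (Fin d) ℝ) ^ n) from h hv
      refine iSup₂_le fun z hz v hv => ?_
      rw [Submodule.mem_comap,
        norm_pow_apply_of_mem_eigenspace (complexify_contragredient_apply A) hz hv]
      exact Submodule.smul_mem _ _
        (Submodule.mem_iSup_of_mem z (Submodule.mem_iSup_of_mem hz hv))
    change Filter.Tendsto _ _ _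
    have : ∀ n : ℕ, ‖(neutralComplex A).mkQ
        ((complexify (contragredient A : Matrix (Fin d) (Fin d) ℝ) ^ n) v)‖ = 0 := by
      intro n
      rw [Submodule.mkQ_apply, (Submodule.Quotient.mk_eq_zero _).2 (h0 n), norm_zero]
    simp only [this]
    exact tendsto_const_nhds) (by
    intro v hv
    exact squeeze_zero (fun _ => norm_nonneg _) (fun n => hmk _) (by simpa using hv.norm))
  exact (this ▸ Submodule.mem_top : v ∈ W)

theorem ExpandingOnSubspace.exists_forall_glEquiv_pow_notMem {A : GL (Fin d) ℝ}
    (hA : ExpandingOnSubspace A) {K : Set (Eucl d)} (hK : IsCompact K)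
    (hKN : Disjoint K (neutralSubspace A)) :
    ∃ L : ℕ, ∀ k, L ≤ k → ∀ x ∈ K, glEquiv (contragredient A ^ k) x ∉ K := by
  rcases K.eq_empty_or_nonempty with rfl | hne
  · simp
  have hcl : IsClosed (neutralComplex A : Set (Fin d → ℂ)) :=
    Submodule.closed_of_finiteDimensional _
  have hmkc : Continuous fun x : Eucl d => ‖(neutralComplex A).mkQ (complexEmb d x)‖ := by
    have h1 : Continuous (neutralComplex A).mkQ := LinearMap.continuous_of_finiteDimensional _
    exact (h1.comp continuous_complexEmb).norm
  obtain ⟨x₀, hx₀, hmin⟩ := hK.exists_isMinOn hne hmkc.continuousOn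
  set δ := ‖(neutralComplex A).mkQ (complexEmb d x₀)‖ with hδ
  have hδ0 : 0 < δ := by
    refine lt_of_le_of_ne (norm_nonneg _) fun h => ?_
    have h2 : complexEmb d x₀ ∈ neutralComplex A := by
      have h3 : complexEmb d x₀ ∈ closure (neutralComplex A : Set (Fin d → ℂ)) :=
        (QuotientAddGroup.norm_mk_eq_zero_iff_mem_closure (S := (neutralComplex A).toAddSubgroup)).1 h.symm
      rwa [hcl.closure_eq] at h3
    exact disjoint_left.1 hKN hx₀ ((mem_neutralSubspace_iff A x₀).2 h2)
  obtain ⟨R, hR⟩ := hK.isBounded.exists_norm_le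
  have hR0 : 0 ≤ R := (norm_nonneg _).trans (hR x₀ hx₀)
  -- Convergence on the finitely many basis vectors is uniform on bounded sets: for `‖x‖ ≤ R` the
  -- quotient norm of the `n`-th iterate is at most `R * a n`.
  set a : ℕ → ℝ := fun n => ∑ i : Fin d, ‖(neutralComplex A).mkQ
    ((complexify (contragredient A : Matrix (Fin d) (Fin d) ℝ) ^ n) (Pi.single i 1))‖ with ha
  have hlim : Filter.Tendsto (fun n => R * a n) Filter.atTop (nhds 0) := by
    have := (tendsto_finsetSum Finset.univ fun (i : Fin d) _ =>
      hA.tendsto_mkQ (Pi.single i 1)).const_mul R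
    rwa [Finset.sum_const_zero, mul_zero] at this
  obtain ⟨L, hL⟩ := Filter.eventually_atTop.1 (hlim.eventually_lt_const hδ0)
  refine ⟨L, fun k hk x hx hmem => ?_⟩
  have h1 : δ ≤ ‖(neutralComplex A).mkQ (complexEmb d (glEquiv (contragredient A ^ k) x))‖ :=
    hmin hmem
  refine absurd (h1.trans ?_) (not_le.2 (hL k hk))
  rw [complexEmb_glEquiv_pow, pi_eq_sum_univ' (complexEmb d x), map_sum, map_sum, ha,
    Finset.mul_sum]
  refine norm_sum_le_of_le _ fun i _ => ?_
  rw [map_smul, map_smul, norm_smul]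
  have hx' : ‖complexEmb d x i‖ ≤ R := by
    rw [complexEmb_apply, Complex.norm_real]
    exact (PiLp.norm_apply_le x i).trans (hR x hx)
  gcongr

/-- `neutralSubspace` as a real subspace. -/
noncomputable def neutralSubmodule (A : GL (Fin d) ℝ) : Submodule ℝ (Eucl d) :=
  ((neutralComplex A).restrictScalars ℝ).comap (complexEmb d)

theorem coe_neutralSubmodule (A : GL (Fin d) ℝ) :
    (neutralSubmodule A : Set (Eucl d)) = neutralSubspace A := rfl

/-- Neutral vectors have bounded orbits under `Aᵀ`, whereas an eigenvector with `‖z‖ > 1` has an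
unbounded one. -/
theorem ExpandingOnSubspace.neutralSubmodule_ne_top {A : GL (Fin d) ℝ}
    (hA : ExpandingOnSubspace A) : neutralSubmodule A ≠ ⊤ := by
  intro htop
  have htop' : neutralComplex A = ⊤ := by
    rw [eq_top_iff]
    intro v _
    rw [pi_eq_sum_univ' v]
    refine Submodule.sum_mem _ fun i _ => Submodule.smul_mem _ _ ?_
    have h : EuclideanSpace.single i (1 : ℝ) ∈ neutralSubmodule A := htop ▸ Submodule.mem_top
    have h2 : complexEmb d (EuclideanSpace.single i (1 : ℝ)) ∈ neutralComplex A := h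
    convert h2 using 1
    ext j
    by_cases hij : i = j
    · simp [complexEmb_apply, hij]
    · simp [complexEmb_apply, Ne.symm hij]
  obtain ⟨z, hz, hz1⟩ := hA.exists_one_lt
  obtain ⟨v, hv, hv0⟩ := ((hasEigenvalue_complexify_transpose _ _).2 hz).exists_hasEigenvector
  obtain ⟨C, hC⟩ := neutralComplex_le_boundedOrbit_transpose A (htop' ▸ Submodule.mem_top : v ∈ _)
  obtain ⟨n, hn⟩ := pow_unbounded_of_one_lt (C / ‖v‖) hz1
  have h := hC n
  rw [eigenvector_pow_apply hv, norm_smul, norm_pow] at h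
  rw [div_lt_iff₀ (norm_pos_iff.2 hv0)] at hn
  exact absurd h (not_le.2 hn)

theorem ExpandingOnSubspace.isBlindSpot_union {A : GL (Fin d) ℝ}
    (hA : ExpandingOnSubspace A) {E : Set (Eucl d)} (hE : IsBlindSpot E) :
    IsBlindSpot (E ∪ neutralSubspace A) := by
  rw [← coe_neutralSubmodule]
  exact ⟨hE.isClosed.union (Submodule.closed_of_finiteDimensional _),
    measure_union_null hE.null (Measure.addHaar_submodule _ _ hA.neutralSubmodule_ne_top)⟩

/-! ### Periodization, Weil's formula and covolumes -/

theorem exists_norm_add_lt_of_compactSpace_quotient {Γ : AddSubgroup (Eucl d)}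
    (hc : CompactSpace (Eucl d ⧸ Γ)) : ∃ R : ℝ, 0 < R ∧ ∀ x : Eucl d, ∃ γ : Γ, ‖x + γ‖ < R := by
  obtain ⟨n, hn⟩ := isCompact_univ.elim_directed_cover
    (fun n : ℕ => (QuotientAddGroup.mk : Eucl d → Eucl d ⧸ Γ) '' Metric.ball 0 (n + 1))
    (fun n => QuotientAddGroup.isOpenMap_coe _ Metric.isOpen_ball)
    (by
      intro q _
      obtain ⟨x, rfl⟩ := QuotientAddGroup.mk_surjective q
      obtain ⟨n, hn⟩ := exists_nat_gt ‖x‖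
      exact mem_iUnion.2 ⟨n, x, by rw [mem_ball_zero_iff]; linarith, rfl⟩)
    (Monotone.directed_le fun m n h => image_mono (Metric.ball_subset_ball (by
      have : (m : ℝ) ≤ n := by exact_mod_cast h
      linarith)))
  refine ⟨n + 1, by positivity, fun x => ?_⟩
  obtain ⟨y, hy, hyx⟩ := hn (mem_univ (x : Eucl d ⧸ Γ))
  have h : -x + y ∈ Γ := QuotientAddGroup.eq.1 hyx.symm
  exact ⟨⟨-x + y, h⟩, by simpa using hy⟩

/-- The sum (integral) of the translates of `f` by elements of `Γ`. -/
noncomputable def periodization (Γ : AddSubgroup (Eucl d)) (μ : Measure Γ) (f : Eucl d → ℝ≥0∞)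
    (x : Eucl d) : ℝ≥0∞ :=
  ∫⁻ γ : Γ, f (x + γ) ∂μ

section
variable {Γ : AddSubgroup (Eucl d)} {μ : Measure Γ}

theorem periodization_add [μ.IsAddHaarMeasure] (f : Eucl d → ℝ≥0∞) (x : Eucl d) (γ₀ : Γ) :
    periodization Γ μ f (x + γ₀) = periodization Γ μ f x := by
  unfold periodization
  rw [← lintegral_add_left_eq_self (fun γ : Γ => f (x + γ)) γ₀]
  simp [add_assoc]

theorem periodization_out [μ.IsAddHaarMeasure] (f : Eucl d → ℝ≥0∞) (x : Eucl d) :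
    periodization Γ μ f (x : Eucl d ⧸ Γ).out = periodization Γ μ f x := by
  have h : -x + (x : Eucl d ⧸ Γ).out ∈ Γ := by
    rw [← QuotientAddGroup.eq]
    exact (QuotientAddGroup.out_eq' _).symm
  have := periodization_add (μ := μ) f x ⟨_, h⟩
  simpa using this

theorem measurable_periodization [SFinite μ] {f : Eucl d → ℝ≥0∞} (hf : Measurable f) :
    Measurable (periodization Γ μ f) :=
  Measurable.lintegral_prod_right' (f := fun p : Eucl d × Γ => f (p.1 + p.2))
    (hf.comp (measurable_fst.add (measurable_subtype_coe.comp measurable_snd)))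

/-- Self-adjointness of periodization, by Tonelli, translation invariance of Lebesgue measure and
the substitution `γ ↦ -γ`. -/
theorem lintegral_periodization_mul [SFinite μ] [μ.IsNegInvariant] {f h : Eucl d → ℝ≥0∞}
    (hf : Measurable f) (hh : Measurable h) :
    ∫⁻ x, periodization Γ μ h x * f x = ∫⁻ x, h x * periodization Γ μ f x := by
  have hm : Measurable fun p : Eucl d × Γ => p.1 + (p.2 : Eucl d) :=
    measurable_fst.add (measurable_subtype_coe.comp measurable_snd)
  have hm' : Measurable fun p : Eucl d × Γ => p.1 - (p.2 : Eucl d) :=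
    measurable_fst.sub (measurable_subtype_coe.comp measurable_snd)
  calc ∫⁻ x, periodization Γ μ h x * f x
      = ∫⁻ x, ∫⁻ γ : Γ, h (x + γ) * f x ∂μ := by
        refine lintegral_congr fun x => ?_
        exact (lintegral_mul_const (f x) (f := fun γ : Γ => h (x + γ))
          (hh.comp (hm.comp measurable_prodMk_left))).symm
    _ = ∫⁻ γ : Γ, (∫⁻ x : Eucl d, h (x + γ) * f x) ∂μ :=
        lintegral_lintegral_swap ((hh.comp hm).mul (hf.comp measurable_fst)).aemeasurable
    _ = ∫⁻ γ : Γ, (∫⁻ x : Eucl d, h x * f (x - γ)) ∂μ := by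
        refine lintegral_congr fun γ => ?_
        rw [← lintegral_add_right_eq_self (fun x => h x * f (x - γ)) (γ : Eucl d)]
        simp
    _ = ∫⁻ x, ∫⁻ γ : Γ, h x * f (x - γ) ∂μ :=
        (lintegral_lintegral_swap ((hh.comp measurable_fst).mul (hf.comp hm')).aemeasurable).symm
    _ = ∫⁻ x, h x * periodization Γ μ f x := by
        refine lintegral_congr fun x => ?_
        refine (lintegral_const_mul (h x) (f := fun γ : Γ => f (x - γ))
          (hf.comp (hm'.comp measurable_prodMk_left))).trans ?_
        rw [periodization, ← lintegral_neg_eq_self (fun γ : Γ => f (x + γ))]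
        simp [sub_eq_add_neg]

theorem continuous_const_add_coe (x : Eucl d) : Continuous fun γ : Γ => x + (γ : Eucl d) :=
  continuous_const.add continuous_subtype_val

theorem periodization_indicator {s : Set (Eucl d)} (hs : MeasurableSet s) (x : Eucl d) :
    periodization Γ μ (s.indicator 1) x = μ ((fun γ : Γ => x + (γ : Eucl d)) ⁻¹' s) :=
  lintegral_indicator_one (μ := μ) ((continuous_const_add_coe x).measurable hs)

theorem measure_preimage_ball_lt_top [h : μ.IsAddHaarMeasure] (hΓ : IsClosed (Γ : Set (Eucl d)))
    (x : Eucl d) (R : ℝ) :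
    μ ((fun γ : Γ => x + (γ : Eucl d)) ⁻¹' Metric.ball 0 R) < ∞ := by
  have hcomp : IsCompact ((Subtype.val : Γ → Eucl d) ⁻¹' Metric.closedBall (-x) R) :=
    hΓ.isClosedEmbedding_subtypeVal.isCompact_preimage (isCompact_closedBall (-x) R)
  have hfin := h.toIsFiniteMeasureOnCompacts.lt_top_of_isCompact hcomp
  refine lt_of_le_of_lt (measure_mono fun γ hγ => ?_) hfin
  rw [mem_preimage, mem_ball_zero_iff] at hγ
  rw [mem_preimage, mem_closedBall_iff_norm, sub_neg_eq_add, add_comm]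
  exact hγ.le

theorem measure_preimage_ball_ne_zero [h : μ.IsAddHaarMeasure] {x : Eucl d} {R : ℝ}
    (hx : ∃ γ : Γ, ‖x + γ‖ < R) :
    μ ((fun γ : Γ => x + (γ : Eucl d)) ⁻¹' Metric.ball 0 R) ≠ 0 := by
  obtain ⟨γ, hγ⟩ := hx
  have ho : IsOpen ((fun γ : Γ => x + (γ : Eucl d)) ⁻¹' Metric.ball 0 R) :=
    Metric.isOpen_ball.preimage (continuous_const_add_coe x)
  have hne : ((fun γ : Γ => x + (γ : Eucl d)) ⁻¹' Metric.ball 0 R).Nonempty :=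
    ⟨γ, mem_ball_zero_iff.2 hγ⟩
  exact h.toIsOpenPosMeasure.open_pos _ ho hne

/-- A Bruhat function: the indicator of a ball meeting every coset, divided by its own
periodization, which is positive by cocompactness and finite because `Γ` is closed. -/
theorem exists_periodization_eq_one [SFinite μ] [μ.IsAddHaarMeasure]
    (hΓ : IsClosed (Γ : Set (Eucl d))) (hc : CompactSpace (Eucl d ⧸ Γ)) :
    ∃ f : Eucl d → ℝ≥0∞, Measurable f ∧ ∀ x, periodization Γ μ f x = 1 := by
  obtain ⟨R, -, hR⟩ := exists_norm_add_lt_of_compactSpace_quotient hc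
  set g : Eucl d → ℝ≥0∞ := (Metric.ball 0 R).indicator 1 with hg
  have hgm : Measurable g := measurable_one.indicator measurableSet_ball
  have hval : ∀ x, periodization Γ μ g x =
      μ ((fun γ : Γ => x + (γ : Eucl d)) ⁻¹' Metric.ball 0 R) :=
    periodization_indicator measurableSet_ball
  have hpos : ∀ x, periodization Γ μ g x ≠ 0 := by
    intro x
    rw [hval]
    exact measure_preimage_ball_ne_zero (hR x)
  have hfin : ∀ x, periodization Γ μ g x ≠ ∞ := by
    intro x
    rw [hval]
    exact (measure_preimage_ball_lt_top hΓ x R).ne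
  refine ⟨fun x => g x / periodization Γ μ g x, hgm.div (measurable_periodization hgm),
    fun x => ?_⟩
  calc ∫⁻ γ : Γ, g (x + γ) / periodization Γ μ g (x + γ) ∂μ
      = ∫⁻ γ : Γ, g (x + γ) * (periodization Γ μ g x)⁻¹ ∂μ :=
        lintegral_congr fun γ => by rw [periodization_add, div_eq_mul_inv]
    _ = periodization Γ μ g x * (periodization Γ μ g x)⁻¹ :=
        lintegral_mul_const _ (hgm.comp (continuous_const_add_coe x).measurable)
    _ = 1 := ENNReal.mul_inv_cancel (hpos x) (hfin x)

/-- The image of `f dx`, for a Bruhat function `f`, works: self-adjointness moves the periodization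
from `h` to `f`, where it equals one. -/
theorem exists_weilFormula [SFinite μ] [μ.IsAddHaarMeasure] [μ.IsNegInvariant]
    (hΓ : IsClosed (Γ : Set (Eucl d))) (hc : CompactSpace (Eucl d ⧸ Γ)) :
    ∃ ν, WeilFormula Γ μ ν := by
  obtain ⟨f, hf, hf1⟩ := exists_periodization_eq_one (μ := μ) hΓ hc
  have hmk : Measurable (QuotientAddGroup.mk : Eucl d → Eucl d ⧸ Γ) := measurable_quotient_mk''
  refine ⟨(volume.withDensity f).map QuotientAddGroup.mk, fun h hh => ?_⟩
  change _ = ∫⁻ q, periodization Γ μ h (Quotient.out q) ∂_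
  have hm : Measurable fun q : Eucl d ⧸ Γ => periodization Γ μ h (Quotient.out q) := by
    refine measurable_from_quotient.2 ?_
    change Measurable fun x : Eucl d => periodization Γ μ h (x : Eucl d ⧸ Γ).out
    simp only [periodization_out]
    exact measurable_periodization hh
  refine Eq.trans ?_ (lintegral_map hm hmk).symm
  simp only [periodization_out]
  rw [lintegral_withDensity_eq_lintegral_mul _ hf (measurable_periodization hh)]
  simp only [Pi.mul_apply, mul_comm (f _)]
  rw [lintegral_periodization_mul hf hh]
  simp [hf1]

/-- Testing Weil's formula on a Bruhat function gives the total mass of whichever measure was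
chosen, so uniqueness is not needed. -/
theorem covol_eq_lintegral [SFinite μ] [μ.IsAddHaarMeasure] [μ.IsNegInvariant]
    (hΓ : IsClosed (Γ : Set (Eucl d))) (hc : CompactSpace (Eucl d ⧸ Γ))
    {f : Eucl d → ℝ≥0∞} (hf : Measurable f) (hf1 : ∀ x, periodization Γ μ f x = 1) :
    covol Γ μ = ∫⁻ x, f x := by
  have hex := exists_weilFormula (μ := μ) hΓ hc
  have hw : WeilFormula Γ μ (quotientMeasure Γ μ) := by
    rw [quotientMeasure, dif_pos hex]
    exact hex.choose_spec
  rw [hw f hf]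
  change _ = ∫⁻ q, periodization Γ μ f (Quotient.out q) ∂_
  simp [hf1, covol]

theorem covol_ne_zero [SFinite μ] [μ.IsAddHaarMeasure] [μ.IsNegInvariant]
    (hΓ : IsClosed (Γ : Set (Eucl d))) (hc : CompactSpace (Eucl d ⧸ Γ)) :
    covol Γ μ ≠ 0 := by
  obtain ⟨f, hf, hf1⟩ := exists_periodization_eq_one (μ := μ) hΓ hc
  rw [covol_eq_lintegral hΓ hc hf hf1]
  intro h0
  -- Paired with the constant `1`, a Bruhat function vanishing almost everywhere would force the
  -- volume of the whole space to be zero.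
  have h := lintegral_periodization_mul (μ := μ) hf (measurable_const (a := (1 : ℝ≥0∞)))
  rw [lintegral_eq_zero_iff hf] at h0
  have h1 : ∫⁻ x, periodization Γ μ (fun _ => 1) x * f x = 0 := by
    rw [lintegral_congr_ae (g := fun _ => 0), lintegral_zero]
    filter_upwards [h0] with x hx
    simp [hx]
  rw [h1] at h
  simp only [hf1, mul_one, lintegral_const, one_mul] at h
  exact isOpen_univ.measure_ne_zero volume univ_nonempty h.symm

theorem sFinite_and_isNegInvariant (hΓ : IsClosed (Γ : Set (Eucl d)))
    (hμ : μ.IsAddHaarMeasure) : SFinite μ ∧ μ.IsNegInvariant := by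
  have : LocallyCompactSpace Γ := hΓ.isClosedEmbedding_subtypeVal.locallyCompactSpace
  exact ⟨inferInstance, inferInstance⟩

end

/-! ### Linear changes of variables, dilations and the Fourier transform -/

theorem map_glEquiv_volume (B : GL (Fin d) ℝ) :
    Measure.map (glEquiv B) volume =
      ENNReal.ofReal |(B : Matrix (Fin d) (Fin d) ℝ).det|⁻¹ • (volume : Measure (Eucl d)) := by
  have hdet : LinearMap.det ((glEquiv B).toLinearEquiv : Eucl d →ₗ[ℝ] Eucl d) =
      (B : Matrix (Fin d) (Fin d) ℝ).det := by
    have : ((glEquiv B).toLinearEquiv : Eucl d →ₗ[ℝ] Eucl d) =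
      Matrix.toEuclideanLin (B : Matrix (Fin d) (Fin d) ℝ) := rfl
    rw [this, Matrix.toEuclideanLin_eq_toLin_orthonormal, LinearMap.det_toLin]
  have hne : LinearMap.det ((glEquiv B).toLinearEquiv : Eucl d →ₗ[ℝ] Eucl d) ≠ 0 :=
    (LinearEquiv.isUnit_det' _).ne_zero
  have hmap := Measure.map_linearMap_addHaar_eq_smul_addHaar (volume : Measure (Eucl d)) hne
  rwa [hdet, abs_inv] at hmap

theorem lintegral_comp_glEquiv (B : GL (Fin d) ℝ) (f : Eucl d → ℝ≥0∞) :
    ∫⁻ x, f (glEquiv B x) =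
      ENNReal.ofReal |(B : Matrix (Fin d) (Fin d) ℝ).det|⁻¹ * ∫⁻ x, f x := by
  have h := lintegral_map_equiv (μ := volume) f (glEquiv B).toHomeomorph.toMeasurableEquiv
  change ∫⁻ x, f x ∂(Measure.map (glEquiv B) volume) = ∫⁻ x, f (glEquiv B x) at h
  rw [← h, map_glEquiv_volume, lintegral_smul_measure, smul_eq_mul]

theorem covol_imageSubgroup (B : GL (Fin d) ℝ) {Γ : AddSubgroup (Eucl d)} {μ : Measure Γ}
    (hΓ : IsClosed (Γ : Set (Eucl d))) (hc : CompactSpace (Eucl d ⧸ Γ))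
    (hμ : μ.IsAddHaarMeasure) :
    covol (imageSubgroup B Γ) (μ.map (imageEquiv B Γ)) =
      ENNReal.ofReal |(B : Matrix (Fin d) (Fin d) ℝ).det| * covol Γ μ := by
  obtain ⟨h1, h2⟩ := sFinite_and_isNegInvariant hΓ hμ
  have hμ' := isAddHaarMeasure_imageSubgroup B μ hμ
  obtain ⟨h3, h4⟩ := sFinite_and_isNegInvariant (isClosed_imageSubgroup B hΓ) hμ'
  obtain ⟨f, hf, hf1⟩ := exists_periodization_eq_one (μ := μ) hΓ hc
  have hBm : Measurable (glEquiv B⁻¹) := (glEquiv B⁻¹).continuous.measurable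
  have hem : Measurable (imageEquiv B Γ) :=
    (Continuous.subtype_mk ((glEquiv B).continuous.comp continuous_subtype_val) _).measurable
  rw [covol_eq_lintegral (μ := μ.map (imageEquiv B Γ)) (f := fun x => f (glEquiv B⁻¹ x))
    (isClosed_imageSubgroup B hΓ) (compactSpace_imageSubgroup B hc) (hf.comp hBm) ?_,
    covol_eq_lintegral hΓ hc hf hf1, lintegral_comp_glEquiv]
  · congr 2
    rw [Matrix.coe_units_inv, Matrix.det_nonsing_inv, Ring.inverse_eq_inv', abs_inv, inv_inv]
  · intro x
    rw [← hf1 (glEquiv B⁻¹ x)]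
    refine (lintegral_map (f := fun γ : imageSubgroup B Γ => f (glEquiv B⁻¹ (x + γ)))
      ((hf.comp hBm).comp (measurable_subtype_coe.const_add x)) hem).trans ?_
    refine lintegral_congr fun γ => ?_
    have : ((imageEquiv B Γ γ : imageSubgroup B Γ) : Eucl d) = glEquiv B γ := rfl
    rw [map_add, this, glEquiv_inv_apply_apply]

theorem det_contragredient (C : GL (Fin d) ℝ) :
    (contragredient C : Matrix (Fin d) (Fin d) ℝ).det =
      (C : Matrix (Fin d) (Fin d) ℝ).det⁻¹ := by
  rw [coe_contragredient, Matrix.det_transpose, Matrix.coe_units_inv, Matrix.det_nonsing_inv,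
    Ring.inverse_eq_inv']

theorem det_ne_zero (C : GL (Fin d) ℝ) : (C : Matrix (Fin d) (Fin d) ℝ).det ≠ 0 :=
  ((Matrix.isUnit_iff_isUnit_det _).1 C.isUnit).ne_zero

theorem inner_glEquiv_contragredient (C : GL (Fin d) ℝ) (x y : Eucl d) :
    ⟪glEquiv C x, glEquiv (contragredient C) y⟫ = ⟪x, y⟫ := by
  have h : (C : Matrix (Fin d) (Fin d) ℝ).transpose *
      (contragredient C : Matrix (Fin d) (Fin d) ℝ) = 1 := by
    rw [coe_contragredient, ← Matrix.transpose_mul, ← Units.val_mul]; simp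
  rw [EuclideanSpace.inner_eq_star_dotProduct, EuclideanSpace.inner_eq_star_dotProduct,
    glEquiv_apply, glEquiv_apply]
  simp only [Matrix.ofLp_toLpLin, star_trivial, Matrix.toLin'_apply]
  rw [Matrix.dotProduct_mulVec, ← Matrix.mulVec_transpose, Matrix.mulVec_mulVec, h,
    Matrix.one_mulVec]

theorem quasiMeasurePreserving_glEquiv (B : GL (Fin d) ℝ) :
    Measure.QuasiMeasurePreserving (glEquiv B) (volume : Measure (Eucl d)) volume :=
  ⟨(glEquiv B).continuous.measurable, by
    rw [map_glEquiv_volume]; exact Measure.smul_absolutelyContinuous⟩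

theorem integral_comp_glEquiv (B : GL (Fin d) ℝ) (f : Eucl d → ℂ) :
    ∫ x, f (glEquiv B x) = (|(B : Matrix (Fin d) (Fin d) ℝ).det|⁻¹ : ℝ) * ∫ x, f x := by
  have h := integral_map_equiv (μ := volume) (glEquiv B).toHomeomorph.toMeasurableEquiv f
  change ∫ x, f x ∂(Measure.map (glEquiv B) volume) = ∫ x, f (glEquiv B x) at h
  rw [← h, map_glEquiv_volume, integral_smul_measure, ENNReal.toReal_ofReal (by positivity),
    Complex.real_smul]

theorem coeFn_dilation (B : GL (Fin d) ℝ) (g : L2 d) :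
    dilation B g =ᵐ[volume] dilationFun B g := (memLp_dilationFun B g).coeFn_toLp

theorem dilation_sub (B : GL (Fin d) ℝ) (g h : L2 d) :
    dilation B (g - h) = dilation B g - dilation B h := by
  apply Lp.ext
  filter_upwards [coeFn_dilation B (g - h), coeFn_dilation B g, coeFn_dilation B h,
    Lp.coeFn_sub (dilation B g) (dilation B h),
    (quasiMeasurePreserving_glEquiv B).ae (Lp.coeFn_sub g h)] with x h1 h2 h3 h4 h5
  rw [h1, h4, Pi.sub_apply, h2, h3, dilationFun, dilationFun, dilationFun, h5, Pi.sub_apply,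
    mul_sub]

theorem exists_norm_dilation_le (B : GL (Fin d) ℝ) : ∃ K : ℝ, ∀ g : L2 d,
    ‖dilation B g‖ ≤ K * ‖g‖ := by
  set a : ℝ≥0∞ := ENNReal.ofReal |(B : Matrix (Fin d) (Fin d) ℝ).det|⁻¹ with ha
  set c : ℂ := ((|(B : Matrix (Fin d) (Fin d) ℝ).det| ^ (1 / 2 : ℝ) : ℝ) : ℂ) with hc
  refine ⟨(‖c‖ₑ * a ^ (1 / (2 : ℝ≥0∞)).toReal).toReal, fun g => ?_⟩
  have h1 : eLpNorm (dilationFun B g) 2 volume =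
      ‖c‖ₑ * a ^ (1 / (2 : ℝ≥0∞)).toReal * eLpNorm g 2 volume := by
    have e1 : dilationFun B g = c • ((g : Eucl d → ℂ) ∘ glEquiv B) := rfl
    have hg : AEStronglyMeasurable (g : Eucl d → ℂ) (Measure.map (glEquiv B) volume) := by
      rw [map_glEquiv_volume]
      exact (Lp.aestronglyMeasurable g).smul_measure _
    rw [e1, eLpNorm_const_smul, ← eLpNorm_map_measure hg (glEquiv B).continuous.aemeasurable,
      map_glEquiv_volume, eLpNorm_smul_measure_of_ne_top (by simp), smul_eq_mul, mul_assoc]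
  rw [dilation, Lp.norm_toLp, h1, ENNReal.toReal_mul, Lp.norm_def]

theorem continuous_dilation (B : GL (Fin d) ℝ) : Continuous (dilation B : L2 d → L2 d) := by
  obtain ⟨K, hK⟩ := exists_norm_dilation_le B
  refine (LipschitzWith.of_dist_le' (K := K) fun g h => ?_).continuous
  rw [dist_eq_norm, dist_eq_norm, ← dilation_sub]
  exact hK _

/-- The dilation of a Schwartz function. -/
noncomputable def schwartzDilation (B : GL (Fin d) ℝ) (φ : SchwartzMap (Eucl d) ℂ) :
    SchwartzMap (Eucl d) ℂ :=
  ((|(B : Matrix (Fin d) (Fin d) ℝ).det| ^ (1 / 2 : ℝ) : ℝ) : ℂ) •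
    SchwartzMap.compCLMOfContinuousLinearEquiv ℂ (glEquiv B) φ

theorem schwartzDilation_apply (B : GL (Fin d) ℝ) (φ : SchwartzMap (Eucl d) ℂ) (x : Eucl d) :
    schwartzDilation B φ x = dilationFun B φ x := rfl

theorem dilation_toLp (B : GL (Fin d) ℝ) (φ : SchwartzMap (Eucl d) ℂ) :
    dilation B (φ.toLp 2) = (schwartzDilation B φ).toLp 2 := by
  apply Lp.ext
  filter_upwards [coeFn_dilation B (φ.toLp 2), (schwartzDilation B φ).coeFn_toLp 2 volume,
    (quasiMeasurePreserving_glEquiv B).ae (φ.coeFn_toLp 2 volume)] with x h1 h2 h3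
  rw [h1, h2, schwartzDilation_apply, dilationFun, dilationFun, h3]

theorem fourier_schwartzDilation (B : GL (Fin d) ℝ) (φ : SchwartzMap (Eucl d) ℂ) :
    𝓕 (schwartzDilation B φ) = schwartzDilation (contragredient B) (𝓕 φ) := by
  ext ω
  rw [schwartzDilation_apply, dilationFun, SchwartzMap.fourier_coe, SchwartzMap.fourier_coe,
    Real.fourier_eq, Real.fourier_eq, det_contragredient]
  set D := |(B : Matrix (Fin d) (Fin d) ℝ).det| with hD
  have hD0 : 0 < D := abs_pos.2 (det_ne_zero B)
  have h1 : ∀ x, Real.fourierChar (-⟪x, ω⟫) • schwartzDilation B φ x =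
      ((D ^ (1 / 2 : ℝ) : ℝ) : ℂ) *
        (fun y => Real.fourierChar (-⟪y, glEquiv (contragredient B) ω⟫) • φ y) (glEquiv B x) := by
    intro x
    simp only [inner_glEquiv_contragredient]
    rw [schwartzDilation_apply, dilationFun, Circle.smul_def, Circle.smul_def, smul_eq_mul,
      smul_eq_mul]
    ring
  simp only [h1]
  rw [integral_const_mul, integral_comp_glEquiv B
    (fun y => Real.fourierChar (-⟪y, glEquiv (contragredient B) ω⟫) • φ y), ← mul_assoc, ← Complex.ofReal_mul, abs_inv,
    ← hD]
  congr 2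
  rw [← Real.rpow_neg_one D, ← Real.rpow_add hD0, ← Real.rpow_mul hD0.le]
  norm_num

/-- Both sides are continuous in `g`, and Schwartz functions, for which the integral formula is
available, are dense. -/
theorem fourier_dilation (B : GL (Fin d) ℝ) (g : L2 d) :
    (𝓕 (dilation B g) : L2 d) = dilation (contragredient B) (𝓕 g) := by
  refine DenseRange.induction_on
    (p := fun g : L2 d => (𝓕 (dilation B g) : L2 d) = dilation (contragredient B) (𝓕 g))
    (SchwartzMap.denseRange_toLpCLM (p := 2) ENNReal.ofNat_ne_top) g
    (isClosed_eq ?_ ?_) ?_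
  · exact (Lp.fourierTransformₗᵢ (Eucl d) ℂ).continuous.comp (continuous_dilation B)
  · exact (continuous_dilation _).comp (Lp.fourierTransformₗᵢ (Eucl d) ℂ).continuous
  · intro φ
    rw [SchwartzMap.toLpCLM_apply, dilation_toLp, SchwartzMap.toLp_fourier_eq,
      SchwartzMap.toLp_fourier_eq, dilation_toLp, fourier_schwartzDilation]

theorem setLIntegral_hat_dilation (B : GL (Fin d) ℝ) (g : L2 d) {K : Set (Eucl d)}
    (hK : MeasurableSet K) :
    ∫⁻ ω in K, ‖hat (dilation B g) ω‖ₑ ^ 2 =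
      ∫⁻ ω in glEquiv (contragredient B)⁻¹ ⁻¹' K, ‖hat g ω‖ₑ ^ 2 := by
  set Q := contragredient B with hQ
  set D := |(Q : Matrix (Fin d) (Fin d) ℝ).det| with hD
  have hD0 : 0 < D := abs_pos.2 (det_ne_zero Q)
  have h1 : hat (dilation B g) =ᵐ[volume] dilationFun Q (hat g) := by
    rw [hat, fourier_dilation]
    exact coeFn_dilation _ _
  have hsq : ‖((D ^ (1 / 2 : ℝ) : ℝ) : ℂ)‖ₑ ^ 2 = ENNReal.ofReal D := by
    rw [← ofReal_norm, Complex.norm_real, Real.norm_of_nonneg (by positivity),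
      ← ENNReal.ofReal_pow (by positivity), ← Real.rpow_natCast, ← Real.rpow_mul hD0.le]
    norm_num
  have hK' : MeasurableSet (glEquiv Q⁻¹ ⁻¹' K) := (glEquiv Q⁻¹).continuous.measurable hK
  rw [← lintegral_indicator hK, ← lintegral_indicator hK']
  set f : Eucl d → ℝ≥0∞ := (glEquiv Q⁻¹ ⁻¹' K).indicator fun ω => ‖hat g ω‖ₑ ^ 2 with hf
  have h2 : ∫⁻ ω, K.indicator (fun ω => ‖hat (dilation B g) ω‖ₑ ^ 2) ω =
      ∫⁻ ω, ENNReal.ofReal D * f (glEquiv Q ω) := by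
    refine lintegral_congr_ae ?_
    filter_upwards [h1] with ω hω
    by_cases hm : ω ∈ K
    · have hm' : glEquiv Q ω ∈ glEquiv Q⁻¹ ⁻¹' K := by
        rwa [mem_preimage, glEquiv_inv_apply_apply]
      rw [indicator_of_mem hm, hf, indicator_of_mem hm', hω, dilationFun, enorm_mul, mul_pow, hsq]
    · have hm' : glEquiv Q ω ∉ glEquiv Q⁻¹ ⁻¹' K := by
        rwa [mem_preimage, glEquiv_inv_apply_apply]
      rw [indicator_of_notMem hm, hf, indicator_of_notMem hm', mul_zero]
  rw [h2, lintegral_const_mul' _ _ ENNReal.ofReal_ne_top, lintegral_comp_glEquiv, ← hD, ← mul_assoc,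
    ← ENNReal.ofReal_mul hD0.le, mul_inv_cancel₀ hD0.ne', ENNReal.ofReal_one, one_mul]

/-! ### Separation and counting in annihilators -/

theorem mem_annihilator_imageSubgroup (B : GL (Fin d) ℝ) (Γ : AddSubgroup (Eucl d)) (α : Eucl d) :
    α ∈ annihilator (imageSubgroup B Γ) ↔ glEquiv (contragredient B⁻¹) α ∈ annihilator Γ := by
  have h : ∀ x : Eucl d, ⟪glEquiv B x, α⟫ = ⟪x, glEquiv (contragredient B⁻¹) α⟫ := by
    intro x
    rw [← inner_glEquiv_contragredient B⁻¹ (glEquiv B x) α, glEquiv_inv_apply_apply]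
  constructor
  · intro hα x hx
    rw [← h]
    exact hα _ ⟨x, hx, rfl⟩
  · rintro hα _ ⟨x, hx, rfl⟩
    have := hα x hx
    rw [← h] at this
    exact this

theorem exists_separated_annihilator {Γ : AddSubgroup (Eucl d)}
    (hc : CompactSpace (Eucl d ⧸ Γ)) : ∃ δ : ℝ, 0 < δ ∧
      ∀ α ∈ annihilator Γ, ∀ β ∈ annihilator Γ, α ≠ β → δ ≤ ‖α - β‖ := by
  obtain ⟨R, hR0, hR⟩ := exists_norm_add_lt_of_compactSpace_quotient hc
  -- If `‖v‖ < 1/(4R)`, take `x` with `⟪x, v⟫ = 1/2` and shift it by `Γ` into the ball of radius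
  -- `R`. The character value stays `-1`, yet `|⟪x + γ, v⟫| ≤ 1/4` makes its real part nonnegative.
  refine ⟨1 / (4 * R), by positivity, fun α hα β hβ hne => ?_⟩
  by_contra! hlt
  set v := α - β with hv
  have hv0 : v ≠ 0 := sub_ne_zero.2 hne
  have hvΓ : ∀ x ∈ Γ, Real.fourierChar ⟪x, v⟫ = 1 := by
    intro x hx
    rw [hv, inner_sub_right, sub_eq_add_neg, AddChar.map_add_eq_mul, AddChar.map_neg_eq_inv,
      hα x hx, hβ x hx, inv_one, mul_one]
  have hvv : ⟪v, v⟫ ≠ 0 := by simpa using hv0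
  set x : Eucl d := (1 / (2 * ⟪v, v⟫)) • v with hx
  have hxv : ⟪x, v⟫ = 1 / 2 := by
    rw [hx, real_inner_smul_left]; field_simp
  obtain ⟨γ, hγ⟩ := hR x
  have h1 : Real.fourierChar ⟪x + γ, v⟫ = Real.fourierChar (1 / 2 : ℝ) := by
    rw [inner_add_left, AddChar.map_add_eq_mul, hvΓ γ γ.2, mul_one, hxv]
  have h2 : |⟪x + γ, v⟫| ≤ 1 / 4 := by
    calc |⟪x + γ, v⟫| ≤ ‖x + γ‖ * ‖v‖ := abs_real_inner_le_norm _ _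
      _ ≤ R * (1 / (4 * R)) := by gcongr
      _ = 1 / 4 := by field_simp
  have h3 := congrArg (fun z : Circle => (z : ℂ).re) h1
  simp only [Real.fourierChar_apply, Complex.exp_re] at h3
  simp only [Complex.mul_re, Complex.mul_im, Complex.ofReal_re, Complex.ofReal_im, Complex.I_re,
    Complex.I_im, mul_zero, mul_one, zero_sub, add_zero, neg_zero, Real.exp_zero,
    one_mul] at h3
  have h4 : 0 ≤ Real.cos (2 * Real.pi * ⟪x + γ, v⟫) := by
    rw [abs_le] at h2
    apply Real.cos_nonneg_of_neg_pi_div_two_le_of_le <;> nlinarith [Real.pi_pos]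
  have h5 : Real.cos (2 * Real.pi * (1 / 2)) = -1 := by
    rw [show 2 * Real.pi * (1 / 2) = Real.pi by ring, Real.cos_pi]
  linarith

/-- Packing: the ellipsoids `α + G⁻¹ B(0, δ/2)` are pairwise disjoint and lie in the ball of radius
`r + ρ`. -/
theorem encard_preimage_inter_closedBall_mul_le {X : Set (Eucl d)} {δ : ℝ}
    (hX : ∀ α ∈ X, ∀ β ∈ X, α ≠ β → δ ≤ ‖α - β‖) (G : GL (Fin d) ℝ) {r ρ : ℝ}
    (hG : ∀ x : Eucl d, ‖x‖ < δ / 2 → ‖glEquiv G⁻¹ x‖ ≤ ρ) :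
    ((glEquiv G ⁻¹' X ∩ Metric.closedBall 0 r).encard : ℝ≥0∞) *
      (ENNReal.ofReal |(G : Matrix (Fin d) (Fin d) ℝ).det|⁻¹ *
        volume (Metric.ball (0 : Eucl d) (δ / 2))) ≤
      volume (Metric.closedBall (0 : Eucl d) (r + ρ)) := by
  set Y := glEquiv G ⁻¹' X ∩ Metric.closedBall 0 r with hY
  set U : Y → Set (Eucl d) := fun α => {x | glEquiv G (x - α) ∈ Metric.ball (0 : Eucl d) (δ / 2)}
    with hU
  have hmeas : ∀ α, MeasurableSet (U α) := fun α =>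
    ((glEquiv G).continuous.measurable.comp (measurable_id.sub_const _)) measurableSet_ball
  have hvol : ∀ α, volume (U α) = ENNReal.ofReal |(G : Matrix (Fin d) (Fin d) ℝ).det|⁻¹ *
        volume (Metric.ball (0 : Eucl d) (δ / 2)) := by
    intro α
    rw [← lintegral_indicator_one measurableSet_ball, ← lintegral_comp_glEquiv,
      ← lintegral_sub_right_eq_self _ (α : Eucl d), ← lintegral_indicator_one (hmeas α)]
    rfl
  have hdisj : Pairwise (Function.onFun Disjoint U) := by
    intro α β hne
    refine disjoint_left.2 fun x hxα hxβ => ?_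
    have h1 : ‖glEquiv G (x - α)‖ < δ / 2 := mem_ball_zero_iff.1 hxα
    have h2 : ‖glEquiv G (x - β)‖ < δ / 2 := mem_ball_zero_iff.1 hxβ
    have h3 := hX _ α.2.1 _ β.2.1 (fun h => hne (Subtype.ext ((glEquiv G).injective h)))
    have h4 : glEquiv G (α : Eucl d) - glEquiv G (β : Eucl d) =
        glEquiv G (x - β) - glEquiv G (x - α) := by
      rw [map_sub, map_sub]; abel
    rw [h4] at h3
    linarith [norm_sub_le (glEquiv G (x - β)) (glEquiv G (x - α))]
  have hsub : ⋃ α, U α ⊆ Metric.closedBall (0 : Eucl d) (r + ρ) := by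
    refine iUnion_subset fun α x hx => ?_
    have h1 := hG _ (mem_ball_zero_iff.1 hx)
    rw [glEquiv_inv_apply_apply] at h1
    have h2 : ‖(α : Eucl d)‖ ≤ r := mem_closedBall_zero_iff.1 α.2.2
    rw [mem_closedBall_zero_iff]
    calc ‖x‖ = ‖(α : Eucl d) + (x - α)‖ := by rw [add_sub_cancel]
      _ ≤ r + ρ := (norm_add_le _ _).trans (add_le_add h2 h1)
  calc _ = ∑' α : Y, volume (U α) := by
        simp only [hvol]
        rw [ENNReal.tsum_const]
        rfl
    _ ≤ volume (⋃ α, U α) := tsum_meas_le_meas_iUnion_of_disjoint volume hmeas hdisj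
    _ ≤ _ := measure_mono hsub

theorem exists_encard_annihilator_le {A : GL (Fin d) ℝ} (hA : ExpandingOnSubspace A)
    {Γ : AddSubgroup (Eucl d)} (hc : CompactSpace (Eucl d ⧸ Γ)) (r : ℝ) :
    ∃ N : ℝ≥0∞, N ≠ ∞ ∧ ∀ m : ℕ,
      ((annihilator (imageSubgroup (A ^ (-(m : ℤ))) Γ) ∩ Metric.closedBall 0 r).encard : ℝ≥0∞) ≤
        N ∧
      ((annihilator (imageSubgroup (A ^ (m : ℤ)) Γ) ∩ Metric.closedBall 0 r).encard : ℝ≥0∞) *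
        ENNReal.ofReal |((A ^ (-(m : ℤ)) : GL (Fin d) ℝ) : Matrix (Fin d) (Fin d) ℝ).det| ≤ N := by
  obtain ⟨δ, hδ, hsep⟩ := exists_separated_annihilator hc
  obtain ⟨C, hC0, hC⟩ := hA.exists_norm_glEquiv_pow_le
  set v := volume (Metric.ball (0 : Eucl d) (δ / 2)) with hv
  have hv0 : v ≠ 0 := (Metric.isOpen_ball.measure_pos volume ⟨0, by simpa using hδ⟩).ne'
  have hvt : v ≠ ∞ := measure_ball_lt_top.ne
  have hset : ∀ B : GL (Fin d) ℝ, annihilator (imageSubgroup B Γ) =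
      glEquiv (contragredient B⁻¹) ⁻¹' annihilator Γ := fun B => by
    ext α; exact mem_annihilator_imageSubgroup B Γ α
  set V₁ := volume (Metric.closedBall (0 : Eucl d) (C * r + δ / 2)) with hV₁
  set V₂ := volume (Metric.closedBall (0 : Eucl d) (r + C * (δ / 2))) with hV₂
  refine ⟨V₁ / v + V₂ / v, ENNReal.add_ne_top.2
    ⟨ENNReal.div_ne_top measure_closedBall_lt_top.ne hv0,
      ENNReal.div_ne_top measure_closedBall_lt_top.ne hv0⟩, fun m => ⟨?_, ?_⟩⟩
  -- `Γ_m^⊥` is carried injectively by the bounded `Q^m` into `Γ^⊥`, so it suffices to count there,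
  -- with `G = 1`.
  · refine le_trans ?_ le_self_add
    rw [ENNReal.le_div_iff_mul_le (Or.inl hv0) (Or.inl hvt)]
    have h := encard_preimage_inter_closedBall_mul_le hsep 1 (r := C * r) (ρ := δ / 2)
      (fun x hx => by rw [inv_one, glEquiv_one_apply]; exact hx.le)
    simp only [Units.val_one, Matrix.det_one, abs_one, inv_one, ENNReal.ofReal_one, one_mul] at h
    refine le_trans (mul_le_mul' (ENat.toENNReal_le.2 ?_) le_rfl) h
    rw [hset]
    refine encard_le_encard_of_injOn (f := glEquiv (contragredient (A ^ (-(m : ℤ)))⁻¹)) ?_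
      (glEquiv _).injective.injOn
    rintro α ⟨h1, h2⟩
    refine ⟨by rw [mem_preimage, glEquiv_one_apply]; exact h1, ?_⟩
    rw [mem_closedBall_zero_iff] at h2 ⊢
    rw [zpow_neg, inv_inv, zpow_natCast, map_pow]
    exact (hC m α).trans (by gcongr)
  -- Here `G = Q^(-m)`: the ellipsoids `G⁻¹ B(0, δ/2)` have uniformly bounded diameter, and their
  -- volume carries the determinant factor.
  · refine le_trans ?_ le_add_self
    rw [ENNReal.le_div_iff_mul_le (Or.inl hv0) (Or.inl hvt), mul_assoc]
    have h := encard_preimage_inter_closedBall_mul_le hsep (contragredient (A ^ (m : ℤ))⁻¹)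
      (r := r) (ρ := C * (δ / 2)) (fun x hx => by
        rw [← map_inv, inv_inv, zpow_natCast, map_pow]
        exact (hC m x).trans (by gcongr))
    rw [← hset, det_contragredient, abs_inv, inv_inv, ← zpow_neg] at h
    exact h

/-! ### Essential supports; the LIC implies the Calderón condition -/

theorem ae_eq_zero_of_notMem_essSupp (h : Eucl d → ℂ) : ∀ᵐ y, y ∉ essSupp h → h y = 0 := by
  rw [ae_iff]
  refine measure_null_of_locally_null _ fun x hx => ?_
  simp only [mem_ofPred_eq, Classical.not_imp] at hx
  have hx1 := hx.1
  simp only [essSupp, mem_ofPred_eq, not_forall, not_not] at hx1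
  obtain ⟨U, hU, hxU, hae⟩ := hx1
  refine ⟨U ∩ {y | ¬(y ∉ essSupp h → h y = 0)},
    Filter.inter_mem (mem_nhdsWithin_of_mem_nhds (hU.mem_nhds hxU)) self_mem_nhdsWithin, ?_⟩
  rw [ae_iff] at hae
  refine measure_mono_null (fun y hy => ?_) hae
  have h2 := hy.2
  simp only [mem_ofPred_eq, Classical.not_imp] at h2 ⊢
  exact ⟨hy.1, h2.2⟩

theorem isClosed_essSupp (h : Eucl d → ℂ) : IsClosed (essSupp h) := by
  rw [← isOpen_compl_iff, isOpen_iff_mem_nhds]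
  intro x hx
  simp only [essSupp, mem_compl_iff, mem_ofPred_eq, not_forall, not_not] at hx
  obtain ⟨U, hU, hxU, hae⟩ := hx
  filter_upwards [hU.mem_nhds hxU] with y hy hmem
  exact hmem U hU hy hae

theorem essSupp_subset_of_isClosed {h : Eucl d → ℂ} {K : Set (Eucl d)} (hK : IsClosed K)
    (hh : ∀ᵐ y, y ∉ K → h y = 0) : essSupp h ⊆ K := by
  intro x hx
  by_contra hxK
  exact hx Kᶜ hK.isOpen_compl hxK hh

theorem aemeasurable_enorm_hat (g : L2 d) : AEMeasurable fun ω => ‖hat g ω‖ₑ ^ 2 :=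
  (Lp.aestronglyMeasurable (𝓕 g : L2 d)).enorm.pow_const 2

theorem lintegral_enorm_hat_lt_top (g : L2 d) : ∫⁻ ω, ‖hat g ω‖ₑ ^ 2 < ∞ := by
  have h := (Lp.memLp (𝓕 g : L2 d)).2
  rw [eLpNorm_lt_top_iff_lintegral_rpow_enorm_lt_top (by simp) (by simp)] at h
  simpa [hat] using h

section GTI

variable {J P : Type*} [Fintype P]

theorem GTISystem.setLIntegral_calderonSum [Countable J] (S : GTISystem d J P) (K : Set (Eucl d)) :
    ∫⁻ ω in K, S.calderonSum ω = ∑' j, (covol (S.Γ j) (S.haar j))⁻¹ *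
      ∑ p, ∫⁻ ω in K, ‖hat (S.gen j p) ω‖ₑ ^ 2 := by
  have hm : ∀ j p, AEMeasurable (fun ω => ‖hat (S.gen j p) ω‖ₑ ^ 2) (volume.restrict K) :=
    fun j p => (aemeasurable_enorm_hat _).restrict
  have hs : ∀ j, AEMeasurable (fun ω => ∑ p, ‖hat (S.gen j p) ω‖ₑ ^ 2) (volume.restrict K) :=
    fun j => Finset.aemeasurable_fun_sum _ fun p _ => hm j p
  unfold GTISystem.calderonSum
  rw [lintegral_tsum fun j => (hs j).const_mul _]
  congr 1
  ext j
  rw [lintegral_const_mul'' _ (hs j), lintegral_finsetSum' _ fun p _ => hm j p]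

/-- The local integrability condition implies the Calderón integrability condition. -/
theorem GTISystem.LIC.calderonIntegrable [Countable J] {S : GTISystem d J P} {E : Set (Eucl d)}
    (h : S.LIC E) : S.CalderonIntegrable E := by
  intro K hK hKE
  set F : L2 d := indicatorConstLp 2 hK.measurableSet hK.measure_lt_top.ne (1 : ℂ) with hF
  set f : L2 d := (𝓕⁻ F : L2 d) with hf
  have hfF : hat f = (F : Eucl d → ℂ) := by
    rw [hat, hf, FourierTransform.fourier_fourierInv_eq]
  have hfK : hat f =ᵐ[volume] K.indicator fun _ => (1 : ℂ) := by
    rw [hfF]; exact indicatorConstLp_coeFn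
  have hsub : essSupp (hat f) ⊆ K := by
    refine essSupp_subset_of_isClosed hK.isClosed ?_
    filter_upwards [hfK] with y hy hyK
    rw [hy, indicator_of_notMem hyK]
  have hfE : f ∈ dSpace E := by
    refine ⟨?_, hK.of_isClosed_subset (isClosed_essSupp _) hsub, hsub.trans hKE⟩
    refine (memLp_indicator_const ∞ hK.measurableSet (1 : ℂ) (Or.inr hK.measure_lt_top.ne)).ae_eq
      hfK.symm
  refine lt_of_le_of_lt ?_ (h f hfE)
  rw [S.setLIntegral_calderonSum]
  gcongr with j p
  have h0 : (0 : Eucl d) ∈ annihilator (S.Γ j) := by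
    intro x _
    simp
  refine le_trans ?_ (ENNReal.le_tsum (⟨0, h0⟩ : annihilator (S.Γ j)))
  rw [← lintegral_indicator hK.measurableSet,
    ← lintegral_indicator (isClosed_essSupp (hat f)).measurableSet]
  refine le_of_eq (lintegral_congr_ae ?_)
  filter_upwards [hfK, ae_eq_zero_of_notMem_essSupp (hat f)] with ω h1 h2
  by_cases hω : ω ∈ essSupp (hat f)
  · rw [indicator_of_mem (hsub hω), indicator_of_mem hω, add_zero, h1,
      indicator_of_mem (hsub hω), one_mul]
  · rw [indicator_of_notMem hω]
    by_cases hωK : ω ∈ K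
    · rw [h1, indicator_of_mem hωK] at h2
      exact absurd (h2 hω) one_ne_zero
    · rw [indicator_of_notMem hωK]

end GTI

/-! ### The Calderón condition implies the LIC -/

/-- A nonzero integrand needs both `ω` and `ω + α` in the support, up to null sets, hence `‖α‖ ≤
2R`. -/
theorem tsum_annihilator_le {f : Eucl d → ℂ} {M : ℝ≥0∞} (hMt : M ≠ ∞) (hM : ∀ᵐ ω, ‖f ω‖ₑ ≤ M) {R : ℝ}
    (hR : ∀ x ∈ essSupp f, ‖x‖ ≤ R) (Λ : Set (Eucl d)) (g : Eucl d → ℂ) :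
    ∑' α : Λ, ∫⁻ ω in essSupp f, ‖f (ω + (α : Eucl d)) * g ω‖ₑ ^ 2 ≤
      ((Λ ∩ Metric.closedBall 0 (2 * R)).encard : ℝ≥0∞) *
        (M ^ 2 * ∫⁻ ω in essSupp f, ‖g ω‖ₑ ^ 2) := by
  set T := M ^ 2 * ∫⁻ ω in essSupp f, ‖g ω‖ₑ ^ 2 with hT
  have hmeas : MeasurableSet (essSupp f) := (isClosed_essSupp f).measurableSet
  have hterm : ∀ α : Eucl d, ∫⁻ ω in essSupp f, ‖f (ω + α) * g ω‖ₑ ^ 2 ≤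
      (Metric.closedBall (0 : Eucl d) (2 * R)).indicator (fun _ => T) α := by
    intro α
    have hq := (measurePreserving_add_right (volume : Measure (Eucl d)) α).quasiMeasurePreserving
    by_cases hα : α ∈ Metric.closedBall (0 : Eucl d) (2 * R)
    · rw [indicator_of_mem hα, hT]
      rw [← lintegral_const_mul' _ _ (ENNReal.pow_ne_top hMt)]
      refine lintegral_mono_ae (ae_restrict_of_ae ?_)
      filter_upwards [hq.ae hM] with ω hω
      rw [enorm_mul, mul_pow]
      gcongr
    · rw [indicator_of_notMem hα, nonpos_iff_eq_zero]
      have : ∀ᵐ ω ∂(volume.restrict (essSupp f)), ‖f (ω + α) * g ω‖ₑ ^ 2 = 0 := by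
        rw [ae_restrict_iff' hmeas]
        filter_upwards [hq.ae (ae_eq_zero_of_notMem_essSupp f)] with ω h1 h2
        rw [h1, zero_mul, enorm_zero, zero_pow two_ne_zero]
        intro h3
        apply hα
        rw [mem_closedBall_zero_iff]
        calc ‖α‖ = ‖(ω + α) - ω‖ := by rw [add_sub_cancel_left]
          _ ≤ ‖ω + α‖ + ‖ω‖ := norm_sub_le _ _
          _ ≤ 2 * R := by linarith [hR _ h2, hR _ h3]
      rw [lintegral_congr_ae this, lintegral_zero]
  calc _ ≤ ∑' α : Λ, (Metric.closedBall (0 : Eucl d) (2 * R)).indicator (fun _ => T) (α : Eucl d) :=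
        ENNReal.tsum_le_tsum fun α => hterm α
    _ = ∑' α : ↥(Λ ∩ Metric.closedBall (0 : Eucl d) (2 * R)), T := by
        rw [tsum_subtype Λ, indicator_indicator, ← tsum_subtype]
    _ = _ := by
        rw [ENNReal.tsum_const]
        rfl

theorem inv_covol_imageSubgroup_zpow (A : GL (Fin d) ℝ) {Γ : AddSubgroup (Eucl d)} {μ : Measure Γ}
    (hΓ : IsClosed (Γ : Set (Eucl d))) (hc : CompactSpace (Eucl d ⧸ Γ))
    (hμ : μ.IsAddHaarMeasure) (j : ℤ) :
    (covol (imageSubgroup (A ^ (-j)) Γ) (μ.map (imageEquiv (A ^ (-j)) Γ)))⁻¹ =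
      ENNReal.ofReal |((A ^ j : GL (Fin d) ℝ) : Matrix (Fin d) (Fin d) ℝ).det| *
        (covol Γ μ)⁻¹ := by
  have h0 : 0 < |((A ^ (-j) : GL (Fin d) ℝ) : Matrix (Fin d) (Fin d) ℝ).det| :=
    abs_pos.2 (det_ne_zero _)
  have h1 : ((A ^ j : GL (Fin d) ℝ) : Matrix (Fin d) (Fin d) ℝ).det =
      ((A ^ (-j) : GL (Fin d) ℝ) : Matrix (Fin d) (Fin d) ℝ).det⁻¹ := by
    rw [← det_contragredient, coe_contragredient, Matrix.det_transpose, zpow_neg, inv_inv]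
  rw [covol_imageSubgroup _ hΓ hc hμ, ENNReal.mul_inv (Or.inl (by simpa using h0.ne'))
    (Or.inl ENNReal.ofReal_ne_top), h1, abs_inv, ENNReal.ofReal_inv_of_pos h0]

theorem tsum_setLIntegral_le {X ι : Type*} [MeasurableSpace X] [Countable ι] {μ : Measure X}
    {F : X → ℝ≥0∞} (hF : AEMeasurable F μ) {s : ι → Set X} (hs : ∀ i, MeasurableSet (s i))
    {L : ℕ} (hL : ∀ x, {i | x ∈ s i}.encard ≤ L) :
    ∑' i, ∫⁻ x in s i, F x ∂μ ≤ L * ∫⁻ x, F x ∂μ := by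
  have h1 : ∀ i, ∫⁻ x in s i, F x ∂μ = ∫⁻ x, (s i).indicator F x ∂μ := fun i =>
    (lintegral_indicator (hs i) F).symm
  simp only [h1]
  rw [← lintegral_tsum fun i => hF.indicator (hs i), ← lintegral_const_mul'' _ hF]
  refine lintegral_mono fun x => ?_
  have h2 : ∀ i, (s i).indicator F x = {i | x ∈ s i}.indicator (fun _ => F x) i := fun i => by
    by_cases h : x ∈ s i
    · rw [indicator_of_mem h, indicator_of_mem (show i ∈ {i | x ∈ s i} from h)]
    · rw [indicator_of_notMem h, indicator_of_notMem (show i ∉ {i | x ∈ s i} from h)]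
  simp only [h2]
  rw [← tsum_subtype, ENNReal.tsum_const]
  gcongr
  exact_mod_cast hL x

theorem exists_encard_zpow_le {Q : GL (Fin d) ℝ} {K : Set (Eucl d)} {L : ℕ}
    (hL : ∀ k, L ≤ k → ∀ x ∈ K, glEquiv (Q ^ k) x ∉ K) (y : Eucl d) :
    {j : ℤ | glEquiv (Q ^ (-j)) y ∈ K}.encard ≤ (2 * L + 1 : ℕ) := by
  -- Two visits to `K` at times at least `L` apart would be a return of a point of `K` to `K`; so
  -- all visits lie within `L` of any given one.
  have hlt : ∀ i j : ℤ, glEquiv (Q ^ (-i)) y ∈ K → glEquiv (Q ^ (-j)) y ∈ K → j - i < L := by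
    intro i j hi hj
    by_contra! h
    obtain ⟨k, hk⟩ := Int.eq_ofNat_of_zero_le ((Int.natCast_nonneg L).trans h)
    refine hL k (by omega) _ hj ?_
    rw [← glEquiv_mul_apply, ← zpow_natCast, ← zpow_add, ← hk]
    convert hi using 3
    ring_nf
  rcases {j : ℤ | glEquiv (Q ^ (-j)) y ∈ K}.eq_empty_or_nonempty with h | ⟨a, ha⟩
  · rw [h, encard_empty]; exact zero_le
  · have hsub : {j : ℤ | glEquiv (Q ^ (-j)) y ∈ K} ⊆ (Finset.Icc (a - L) (a + L) : Finset ℤ) := by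
      intro j hj
      have h1 := hlt a j ha hj
      have h2 := hlt j a hj ha
      rw [Finset.coe_Icc, mem_Icc]
      omega
    refine (encard_le_encard hsub).trans ?_
    rw [encard_coe_eq_coe_finsetCard, Int.card_Icc]
    exact_mod_cast (by omega : (a + L + 1 - (a - L)).toNat ≤ 2 * L + 1)

/-- For a matrix which is expanding on a subspace, the Calderón integrability condition implies the
local integrability condition if the blind spot contains the neutral subspace. -/
theorem waveletSystem_lic_of_calderonIntegrable {P : Type*} [Fintype P] {A : GL (Fin d) ℝ}
    (hA : ExpandingOnSubspace A) {Γ : AddSubgroup (Eucl d)}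
    (hΓ : IsClosed (Γ : Set (Eucl d))) (hc : CompactSpace (Eucl d ⧸ Γ)) {μ : Measure Γ}
    (hμ : μ.IsAddHaarMeasure) {g : P → L2 d} {E : Set (Eucl d)} (hE : neutralSubspace A ⊆ E)
    (h : (waveletSystem A Γ hΓ hc μ hμ g).CalderonIntegrable E) :
    (waveletSystem A Γ hΓ hc μ hμ g).LIC E := by
  rintro f ⟨hfb, hK, hKE⟩
  set S := waveletSystem A Γ hΓ hc μ hμ g with hS
  set K := essSupp (hat f) with hKdef
  have hKm : MeasurableSet K := (isClosed_essSupp _).measurableSet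
  have hCal := h K hK hKE
  rw [S.setLIntegral_calderonSum] at hCal
  obtain ⟨R, hR⟩ := hK.isBounded.exists_norm_le
  obtain ⟨N, hN, hcount⟩ := exists_encard_annihilator_le hA hc (2 * R)
  obtain ⟨L, hL⟩ := hA.exists_forall_glEquiv_pow_notMem hK
    (disjoint_left.2 fun x hx hxN => hKE hx (hE hxN))
  set Q := contragredient A with hQ
  set M := eLpNorm (hat f) ∞ volume with hM
  have hMt : M ≠ ∞ := hfb.2.ne
  have hMae : ∀ᵐ ω, ‖hat f ω‖ₑ ≤ M := by
    rw [hM, eLpNorm_exponent_top]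
    exact ae_le_eLpNormEssSup
  obtain ⟨_, _⟩ := sFinite_and_isNegInvariant hΓ hμ
  set c := (covol Γ μ)⁻¹ with hcdef
  have hct : c ≠ ∞ := ENNReal.inv_ne_top.2 (covol_ne_zero hΓ hc)
  set I : ℤ → ℝ≥0∞ := fun j => ∑ p, ∫⁻ ω in K, ‖hat (S.gen j p) ω‖ₑ ^ 2 with hI
  set w : ℤ → ℝ≥0∞ := fun j => (covol (S.Γ j) (S.haar j))⁻¹ with hw
  have hwj : ∀ j, w j =
      ENNReal.ofReal |((A ^ j : GL (Fin d) ℝ) : Matrix (Fin d) (Fin d) ℝ).det| * c := fun j =>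
    inv_covol_imageSubgroup_zpow A hΓ hc hμ j
  set n : ℤ → ℝ≥0∞ := fun j =>
    ((annihilator (S.Γ j) ∩ Metric.closedBall 0 (2 * R)).encard : ℝ≥0∞) with hn
  -- For `j ≥ 0` the count itself is bounded; for `j ≤ 0` it is the count times `|det A^j| = w j /
  -- c`.
  have hnw : ∀ j, n j * w j ≤ N * w j + N * c := by
    intro j
    obtain ⟨m, rfl | rfl⟩ := j.eq_nat_or_neg
    · exact (mul_le_mul' (hcount m).1 le_rfl).trans le_self_add
    · refine le_trans ?_ le_add_self
      rw [hwj, ← mul_assoc]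
      refine mul_le_mul' ?_ le_rfl
      have h2 := (hcount m).2
      have hΓm : S.Γ (-(m : ℤ)) = imageSubgroup (A ^ (m : ℤ)) Γ := by
        rw [hS]
        change imageSubgroup (A ^ (-(-(m : ℤ)))) Γ = _
        rw [neg_neg]
      simp only [hn, hΓm]
      exact h2
  have hIj : ∀ j, I j = ∑ p, ∫⁻ ω in {y | glEquiv (Q ^ (-j)) y ∈ K}, ‖hat (g p) ω‖ₑ ^ 2 := by
    intro j
    refine Finset.sum_congr rfl fun p _ => ?_
    have h1 := setLIntegral_hat_dilation (A ^ j) (g p) hKm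
    rw [map_zpow, ← zpow_neg] at h1
    exact h1
  have hIsum : ∑' j, I j ≠ ∞ := by
    simp only [hIj]
    rw [Summable.tsum_finsetSum fun p _ => ENNReal.summable]
    refine ENNReal.sum_ne_top.2 fun p _ => ?_
    refine ne_top_of_le_ne_top ?_ (tsum_setLIntegral_le (aemeasurable_enorm_hat (g p))
      (fun j => (glEquiv (Q ^ (-j))).continuous.measurable hKm) (exists_encard_zpow_le hL))
    exact ENNReal.mul_ne_top (ENNReal.natCast_ne_top _) (lintegral_enorm_hat_lt_top (g p)).ne
  calc _ ≤ ∑' j, (M ^ 2 * N * (w j * I j) + M ^ 2 * N * c * I j) := by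
        refine ENNReal.tsum_le_tsum fun j => ?_
        calc _ ≤ w j * ∑ p, n j * (M ^ 2 * ∫⁻ ω in K, ‖hat (S.gen j p) ω‖ₑ ^ 2) := by
              gcongr with p
              exact tsum_annihilator_le hMt hMae hR _ _
          _ = M ^ 2 * (n j * w j) * I j := by
              rw [← Finset.mul_sum, ← Finset.mul_sum]
              ring
          _ ≤ M ^ 2 * (N * w j + N * c) * I j := by
              gcongr
              exact hnw j
          _ = _ := by ring
    _ = M ^ 2 * N * ∑' j, w j * I j + M ^ 2 * N * c * ∑' j, I j := by
        rw [ENNReal.tsum_add, ENNReal.tsum_mul_left, ENNReal.tsum_mul_left]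
    _ < ∞ := by
        have hMN : M ^ 2 * N ≠ ∞ := ENNReal.mul_ne_top (ENNReal.pow_ne_top hMt) hN
        exact ENNReal.add_lt_top.2 ⟨ENNReal.mul_lt_top hMN.lt_top hCal,
          ENNReal.mul_lt_top (ENNReal.mul_ne_top hMN hct).lt_top hIsum.lt_top⟩

end

theorem mainTheorem11 {d : ℕ} {P : Type*} [Fintype P] (A : GL (Fin d) ℝ)
    (hA : ExpandingOnSubspace A) (hdet : 1 < |(A : Matrix (Fin d) (Fin d) ℝ).det|)
    (Γ : AddSubgroup (Eucl d)) (hΓ : IsClosed (Γ : Set (Eucl d)))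
    (hc : CompactSpace (Eucl d ⧸ Γ)) (μ : Measure Γ) (hμ : μ.IsAddHaarMeasure)
    (g : P → L2 d) :
    (∀ E : Set (Eucl d), IsBlindSpot E → neutralSubspace A ⊆ E →
      ((waveletSystem A Γ hΓ hc μ hμ g).LIC E ↔
        (waveletSystem A Γ hΓ hc μ hμ g).CalderonIntegrable E)) ∧
    (∀ E : Set (Eucl d), IsBlindSpot E → (waveletSystem A Γ hΓ hc μ hμ g).LIC E →
      (waveletSystem A Γ hΓ hc μ hμ g).CalderonIntegrable E) ∧
    ((∃ E : Set (Eucl d), IsBlindSpot E ∧ (waveletSystem A Γ hΓ hc μ hμ g).LIC E) ↔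
      ∃ E : Set (Eucl d), IsBlindSpot E ∧
        (waveletSystem A Γ hΓ hc μ hμ g).CalderonIntegrable E) := by
  refine ⟨fun E _ hNE => ⟨fun h => h.calderonIntegrable,
      waveletSystem_lic_of_calderonIntegrable hA hΓ hc hμ hNE⟩,
    fun E _ h => h.calderonIntegrable,
    fun ⟨E, hE, h⟩ => ⟨E, hE, h.calderonIntegrable⟩, fun ⟨E, hE, h⟩ => ?_⟩
  -- Enlarging the blind spot keeps the Calderón condition, since fewer compact sets are tested, and
  -- makes the converse applicable.
  refine ⟨E ∪ neutralSubspace A, hA.isBlindSpot_union hE,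
    waveletSystem_lic_of_calderonIntegrable hA hΓ hc hμ subset_union_right fun K hK hKE => ?_⟩
  exact h K hK (hKE.trans (compl_subset_compl.2 subset_union_left))
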